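/- Theorem 1.2. Let $\sigma\ge 1$, $\sigma/2<\delta_2<\sigma$, $s\ge 0$, $j\in\{0,1\}$, and let $n>2\sigma$. Write $\hat f(\xi)=\int_{\mathbb R^n}e^{-ix\cdot\xi}f(x)\,dx$, let $\mathfrak F^{-1}$ be the inverse of this transform, and let $|D|^s$ and $(-\Delta)^{a}$ be the operators with symbols $|\xi|^s$ and $|\xi|^{2a}$. Let $$u_0\in L^1(\mathbb R^n)\cap H^{s+2j\delta_2}(\mathbb R^n),\qquad u_1\in L^1(\mathbb R^n)\cap H^{\max\{s+2(j-1)\delta_2,\,0\}}(\mathbb R^n),\qquad P_1=\int_{\mathbb R^n}u_1(x)\,dx,$$ and let $u\in C([0,\infty);L^2(\mathbb R^n))$ be a solution (in the sense of distributions in $x$) of $$u_{tt}+(-\Delta)^\sigma u+(-\Delta)^{\delta_2}u_t=0,\qquad u(0,x)=u_0(x),\quad u_t(0,x)=u_1(x).$$ Then for $t>0$ we have $u(t,\cdot)\in H^s$, the map $t\mapsto |D|^su(t,\cdot)\in L^2$ is differentiable, the two profiles below belong to $H^s$, and, as $t\to\infty$, $$\Big\||D|^s\Big(u(t,\cdot)-P_1\,\mathfrak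 F^{-1}\Big(e^{-\frac12t|\xi|^{2\delta_2}}\frac{\sin(t|\xi|^\sigma)}{|\xi|^\sigma}\Big)\Big)\Big\|_{L^2}=o\Big(t^{-\frac n{4\delta_2}-\frac s{2\delta_2}+\frac{\sigma}{2\delta_2}}\Big),$$ $$\Big\|\partial_t|D|^su(t,\cdot)-P_1\,|D|^s\mathfrak F^{-1}\Big(e^{-\frac12t|\xi|^{2\delta_2}}\cos(t|\xi|^\sigma)\Big)\Big\|_{L^2}=o\Big(t^{-\frac n{4\delta_2}-\frac s{2\delta_2}}\Big).$$ Moreover, if $P_1\ne 0$, then there are constants $C_1,C_2>0$ such that for all sufficiently large $t$ $$C_1\,t^{-\frac n{4\delta_2}-\frac{s+(j-1)\sigma}{2\delta_2}}\le\big\|\partial_t^j|D|^su(t,\cdot)\big\|_{L^2}\le C_2\,t^{-\frac n{4\delta_2}-\frac{s+(j-1)\sigma}{2\delta_2}}.$$ -/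

import Mathlib

open MeasureTheory Filter Asymptotics
open scoped FourierTransform SchwartzMap

noncomputable section

namespace StructuralDamping

/-- The space `L²(ℝⁿ; ℂ)` with Lebesgue measure. -/
abbrev L2 (n : ℕ) : Type :=
  Lp ℂ 2 (volume : Measure (EuclideanSpace ℝ (Fin n)))

/-- The Fourier transform with angular frequency, `f̂(ξ) = ∫ e^{-i x·ξ} f(x) dx`, of an `L²` function
(extended from Schwartz functions by Plancherel). Mathlib's `𝓕` has the kernel `e^{-2πi x·η}`, so
that `f̂(ξ) = 𝓕 f (ξ / 2π)`. The value is a function determined up to a null set. -/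
def fourierHat {n : ℕ} (f : L2 n) : EuclideanSpace ℝ (Fin n) → ℂ :=
  fun ξ => ((𝓕 f : L2 n) : EuclideanSpace ℝ (Fin n) → ℂ) ((2 * Real.pi)⁻¹ • ξ)

open Classical in
/-- The inverse transform `F⁻¹ m (x) = (2π)⁻ⁿ ∫ e^{i x·ξ} m(ξ) dξ` on `L²`, i.e. `𝓕⁻` of
`η ↦ m (2π η)`. It is set to `0` if `m` is not square integrable. -/
def invFourier {n : ℕ} (m : EuclideanSpace ℝ (Fin n) → ℂ) : L2 n :=
  if h : MemLp (fun η : EuclideanSpace ℝ (Fin n) => m ((2 * Real.pi) • η)) 2 volume then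
    𝓕⁻ (h.toLp : L2 n)
  else 0

/-- `|D|ˢ f = F⁻¹(|ξ|ˢ f̂)`, for `f ∈ L²` with `|ξ|ˢ f̂ ∈ L²`. -/
def absD {n : ℕ} (s : ℝ) (f : L2 n) : L2 n :=
  invFourier fun ξ => ((‖ξ‖ ^ s : ℝ) : ℂ) * fourierHat f ξ

/-- The fractional Laplacian `(-Δ)ᵃ`, the operator with symbol `|ξ|^{2a}`. -/
def fracLaplacian {n : ℕ} (a : ℝ) (f : L2 n) : L2 n := absD (2 * a) f

/-- `u ∈ C([0,∞); L²)` solves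
`u_tt + (-Δ)^σ u + (-Δ)^δ u_t = 0`, `u(0) = u₀`, `u_t(0) = u₁`
in the sense of distributions in `x`: for every Schwartz function `φ`, the functions
`⟨φ, u(t)⟩` (twice) and `⟨(-Δ)^δ φ, u(t)⟩` (once) are differentiable on `[0,∞)`
(one-sidedly at `0`), and
`∂ₜ² ⟨φ, u(t)⟩ + ⟨(-Δ)^σ φ, u(t)⟩ + ∂ₜ ⟨(-Δ)^δ φ, u(t)⟩ = 0`. -/
structure IsSolution {n : ℕ} (σ δ : ℝ) (u₀ u₁ : L2 n) (u : ℝ → L2 n) : Prop where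
  continuousOn : ContinuousOn u (Set.Ici 0)
  initial : u 0 = u₀
  equation : ∀ φ : 𝓢(EuclideanSpace ℝ (Fin n), ℂ), ∃ p' p'' q' : ℝ → ℂ,
    p' 0 = inner ℂ (φ.toLp 2 : L2 n) u₁ ∧
    ∀ t : ℝ, 0 ≤ t →
      HasDerivWithinAt (fun τ => inner ℂ (φ.toLp 2 : L2 n) (u τ)) (p' t) (Set.Ici 0) t ∧
      HasDerivWithinAt p' (p'' t) (Set.Ici 0) t ∧
      HasDerivWithinAt (fun τ => inner ℂ (fracLaplacian δ (φ.toLp 2 : L2 n)) (u τ))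
        (q' t) (Set.Ici 0) t ∧
      p'' t + inner ℂ (fracLaplacian σ (φ.toLp 2 : L2 n)) (u t) + q' t = 0

/-- The Sobolev space `Hˢ = Hˢ_2(ℝⁿ)`, as a condition on `L²` functions. -/
def MemH {n : ℕ} (s : ℝ) (f : L2 n) : Prop :=
  TemperedDistribution.MemSobolev s 2 (f : 𝓢'(EuclideanSpace ℝ (Fin n), ℂ))

/-- The function `e^{-t|ξ|^{2δ}/2} sin(t|ξ|^σ) / |ξ|^σ`. -/
def sinSymbol {n : ℕ} (σ δ t : ℝ) : EuclideanSpace ℝ (Fin n) → ℂ :=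
  fun ξ => ((Real.exp (-(1 / 2) * t * ‖ξ‖ ^ (2 * δ)) *
    (Real.sin (t * ‖ξ‖ ^ σ) / ‖ξ‖ ^ σ) : ℝ) : ℂ)

/-- The function `e^{-t|ξ|^{2δ}/2} cos(t|ξ|^σ)`. -/
def cosSymbol {n : ℕ} (σ δ t : ℝ) : EuclideanSpace ℝ (Fin n) → ℂ :=
  fun ξ => ((Real.exp (-(1 / 2) * t * ‖ξ‖ ^ (2 * δ)) * Real.cos (t * ‖ξ‖ ^ σ) : ℝ) : ℂ)

end StructuralDamping

end

/-! On the Fourier side the equation is, for each frequency, the damped oscillator `y'' + 2ay' + by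
= 0` with `a = |ξ|^{2δ}/2` and `b = |ξ|^{2σ}`. A distributional solution is first identified with
the explicit combination of kernels (`IsSolution.fourier_eq`): testing against functions compactly
supported in frequency and integrating twice in time gives an a.e. identity free of time
derivatives; after cutting off to `|ξ| ≤ R` it becomes a linear ODE in `L²` with bounded
coefficients, whose solution is unique.

The assumption `σ/2 < δ < σ` then acts differently at the two ends of the spectrum. For `|ξ| ≥ 1`
the decay rate is at least `|ξ|^{2(σ-δ)}/2`, an unbounded power since `δ < σ`: for `t > 0` it
absorbs every weight `|ξ|^s` and leaves an exponentially small contribution (`exists_high_bound`).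
For `|ξ| < 1` one has `a ≤ |ξ|^σ/2`, so the kernels oscillate with frequency `√(b - a²)`, within
`a²/|ξ|^σ` of `|ξ|^σ`. Replacing it by `|ξ|^σ` costs relative errors `t a²/|ξ|^σ` and `a/|ξ|^σ`.

The dilation `|ξ| = t^{-1/(2δ)}|ζ|` makes `t|ξ|^{2δ}` independent of `t`, so the stated rates come
out as prefactors (`norm_eq_dilated`). The errors become powers `|ξ|^{2δ-σ}` and `|ξ|^σ` that vanish
pointwise, and `û₁(ξ) → û₁(0) = P₁` because `u₁ ∈ L¹`; dominated convergence gives both `o`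
statements (`low_frequency_isLittleO`, `sub_profile_isLittleO`). The condition `n > 2σ` makes the
envelope `|ζ|^{s-σ}` square integrable at the origin.

For the two-sided bounds, the dilated profile contains `sin` or `cos` of `τ|ζ|^σ` with `τ =
t^{1-σ/(2δ)} → ∞`. On a fixed annulus the mean of its square stays bounded below, so the profile has
exactly the claimed size (`profile_bounds`), and the `o` error cannot cancel it when `P₁ ≠ 0`. -/

noncomputable section

namespace StructuralDamping

/-! ### Kernels of the damped oscillator at a fixed frequency. -/

section kernels

/-- A square root of the discriminant `a² - b` with nonnegative real part. -/
def rootGap (a b : ℝ) : ℂ := (√(a ^ 2 - b) : ℝ) + (√(b - a ^ 2) : ℝ) * Complex.I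

/-- Real `√` vanishes on nonpositive numbers, so at most one of the two summands of `rootGap` is
nonzero. -/
lemma rootGap_sq (a b : ℝ) : rootGap a b ^ 2 = (a : ℂ) ^ 2 - b := by
  rcases le_total (a ^ 2) b with h | h
  · have h1 : √(a ^ 2 - b) = 0 := Real.sqrt_eq_zero_of_nonpos (by linarith)
    have h2 : √(b - a ^ 2) ^ 2 = b - a ^ 2 := Real.sq_sqrt (by linarith)
    have h3 : ((√(b - a ^ 2) : ℝ) : ℂ) ^ 2 = b - a ^ 2 := by
      rw [← Complex.ofReal_pow, h2]; push_cast; ring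
    rw [rootGap, h1, Complex.ofReal_zero, zero_add, mul_pow, h3, Complex.I_sq]
    ring
  · have h1 : √(b - a ^ 2) = 0 := Real.sqrt_eq_zero_of_nonpos (by linarith)
    have h2 : √(a ^ 2 - b) ^ 2 = a ^ 2 - b := Real.sq_sqrt (by linarith)
    have h3 : ((√(a ^ 2 - b) : ℝ) : ℂ) ^ 2 = a ^ 2 - b := by
      rw [← Complex.ofReal_pow, h2]; push_cast; ring
    rw [rootGap, h1, Complex.ofReal_zero, zero_mul, add_zero, h3]

lemma rootGap_re (a b : ℝ) : (rootGap a b).re = √(a ^ 2 - b) := by simp [rootGap]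

lemma rootGap_re_le {a b : ℝ} (ha : 0 ≤ a) (hb : 0 ≤ b) : (rootGap a b).re ≤ a := by
  rw [rootGap_re]
  exact Real.sqrt_le_iff.2 ⟨ha, by linarith⟩

/-- `sinh (z t) / z`, extended continuously to `z = 0`. -/
def sinhQuot (z : ℂ) (t : ℝ) : ℂ := if z = 0 then t else Complex.sinh (z * t) / z

@[simp] lemma sinhQuot_zero (z : ℂ) : sinhQuot z 0 = 0 := by
  by_cases h : z = 0 <;> simp [sinhQuot, h]

lemma hasDerivAt_mul_ofReal (z : ℂ) (t : ℝ) : HasDerivAt (fun τ : ℝ => z * (τ : ℂ)) z t := by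
  simpa using (Complex.ofRealCLM.hasDerivAt (x := t)).const_mul z

lemma hasDerivAt_sinhQuot (z : ℂ) (t : ℝ) :
    HasDerivAt (sinhQuot z) (Complex.cosh (z * t)) t := by
  by_cases h : z = 0
  · subst h
    have : sinhQuot 0 = fun τ : ℝ => (τ : ℂ) := by funext τ; simp [sinhQuot]
    rw [this]
    rw [zero_mul, Complex.cosh_zero]
    exact Complex.ofRealCLM.hasDerivAt (x := t)
  · have : sinhQuot z = fun τ : ℝ => Complex.sinh (z * τ) / z := by funext τ; simp [sinhQuot, h]
    rw [this]
    have := ((Complex.hasDerivAt_sinh (z * t)).comp t (hasDerivAt_mul_ofReal z t)).div_const z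
    rwa [mul_div_cancel_right₀ _ h] at this

lemma hasDerivAt_cosh_mul (z : ℂ) (t : ℝ) :
    HasDerivAt (fun τ : ℝ => Complex.cosh (z * τ)) (z ^ 2 * sinhQuot z t) t := by
  refine ((Complex.hasDerivAt_cosh (z * t)).comp t (hasDerivAt_mul_ofReal z t)).congr_deriv ?_
  by_cases h : z = 0
  · simp [h]
  · simp only [sinhQuot, h, if_false]; field_simp

lemma norm_cosh_mul_le {z : ℂ} (hz : 0 ≤ z.re) {t : ℝ} (ht : 0 ≤ t) :
    ‖Complex.cosh (z * t)‖ ≤ Real.exp (z.re * t) := by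
  have h1 : ‖Complex.exp (z * t)‖ = Real.exp (z.re * t) := by simp [Complex.norm_exp]
  have h2 : ‖Complex.exp (-(z * t))‖ ≤ Real.exp (z.re * t) := by
    rw [Complex.norm_exp]
    apply Real.exp_le_exp.2
    simp
    nlinarith [mul_nonneg hz ht]
  rw [Complex.cosh, norm_div]
  have := norm_add_le (Complex.exp (z * t)) (Complex.exp (-(z * t)))
  simp only [Complex.norm_ofNat]
  linarith

/-- The mean value inequality, with derivative `cosh`, avoids dividing by `z`; the bound is
therefore uniform near the double root `z = 0`. -/
lemma norm_sinhQuot_le {z : ℂ} (hz : 0 ≤ z.re) {t : ℝ} (ht : 0 ≤ t) :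
    ‖sinhQuot z t‖ ≤ t * Real.exp (z.re * t) := by
  have := (convex_Icc 0 t).norm_image_sub_le_of_norm_hasDerivWithin_le
    (f := sinhQuot z) (f' := fun τ : ℝ => Complex.cosh (z * τ)) (C := Real.exp (z.re * t))
    (fun x _ => (hasDerivAt_sinhQuot z x).hasDerivWithinAt)
    (fun x hx => (norm_cosh_mul_le hz hx.1).trans
      (Real.exp_le_exp.2 (mul_le_mul_of_nonneg_left hx.2 hz)))
    (Set.left_mem_Icc.2 ht) (Set.right_mem_Icc.2 ht)
  rw [sinhQuot_zero, sub_zero, sub_zero, Real.norm_of_nonneg ht] at this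
  linarith

/-- The solution of `y'' + 2 a y' + b y = 0`, `y(0) = 0`, `y'(0) = 1`. -/
def kerOne (a b t : ℝ) : ℂ := Real.exp (-a * t) * sinhQuot (rootGap a b) t

/-- The solution of `y'' + 2 a y' + b y = 0`, `y(0) = 1`, `y'(0) = 0`. -/
def kerZero (a b t : ℝ) : ℂ :=
  Real.exp (-a * t) * (Complex.cosh (rootGap a b * t) + a * sinhQuot (rootGap a b) t)

/-- The time derivative of `kerOne`. -/
def kerOneDeriv (a b t : ℝ) : ℂ :=
  Real.exp (-a * t) * (Complex.cosh (rootGap a b * t) - a * sinhQuot (rootGap a b) t)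

@[simp] lemma kerOne_zero (a b : ℝ) : kerOne a b 0 = 0 := by simp [kerOne]
@[simp] lemma kerZero_zero (a b : ℝ) : kerZero a b 0 = 1 := by simp [kerZero]
@[simp] lemma kerOneDeriv_zero (a b : ℝ) : kerOneDeriv a b 0 = 1 := by simp [kerOneDeriv]

lemma hasDerivAt_ofReal_exp (a t : ℝ) :
    HasDerivAt (fun τ : ℝ => ((Real.exp (-a * τ) : ℝ) : ℂ)) (Real.exp (-a * t) * (-a)) t := by
  have := (((hasDerivAt_id t).const_mul (-a)).exp).ofReal_comp
  simpa using this

lemma hasDerivAt_kerOne (a b t : ℝ) : HasDerivAt (kerOne a b) (kerOneDeriv a b t) t := by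
  have := (hasDerivAt_ofReal_exp a t).mul (hasDerivAt_sinhQuot (rootGap a b) t)
  refine this.congr_deriv ?_
  rw [kerOneDeriv]; ring

lemma hasDerivAt_kerZero (a b t : ℝ) : HasDerivAt (kerZero a b) (-b * kerOne a b t) t := by
  have := (hasDerivAt_ofReal_exp a t).mul ((hasDerivAt_cosh_mul (rootGap a b) t).add
    ((hasDerivAt_sinhQuot (rootGap a b) t).const_mul (a : ℂ)))
  refine this.congr_deriv ?_
  rw [kerOne, rootGap_sq]; simp only [Pi.add_apply]; ring

lemma hasDerivAt_kerOneDeriv (a b t : ℝ) :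
    HasDerivAt (kerOneDeriv a b) (-(2 * a) * kerOneDeriv a b t - b * kerOne a b t) t := by
  have := (hasDerivAt_ofReal_exp a t).mul ((hasDerivAt_cosh_mul (rootGap a b) t).sub
    ((hasDerivAt_sinhQuot (rootGap a b) t).const_mul (a : ℂ)))
  refine this.congr_deriv ?_
  rw [kerOne, kerOneDeriv, rootGap_sq]; simp only [Pi.sub_apply]; ring

/-- The parameter `μ` is a guaranteed decay rate: it is taken to be `0` where only boundedness
matters and `|ξ|^{2(σ-δ)}/2` at high frequencies. -/
lemma exp_mul_exp_re_le {a b μ t : ℝ} (hμ : (rootGap a b).re + μ ≤ a) (ht : 0 ≤ t) :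
    Real.exp (-a * t) * Real.exp ((rootGap a b).re * t) ≤ Real.exp (-μ * t) := by
  rw [← Real.exp_add]
  apply Real.exp_le_exp.2
  nlinarith [mul_le_mul_of_nonneg_right hμ ht]

lemma norm_kerOne_le {a b μ t : ℝ} (hμ : (rootGap a b).re + μ ≤ a) (ht : 0 ≤ t) :
    ‖kerOne a b t‖ ≤ t * Real.exp (-μ * t) := by
  have hz : 0 ≤ (rootGap a b).re := by rw [rootGap_re]; positivity
  rw [kerOne, norm_mul, Complex.norm_real, Real.norm_of_nonneg (Real.exp_pos _).le]
  calc _ ≤ Real.exp (-a * t) * (t * Real.exp ((rootGap a b).re * t)) := by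
        gcongr; exact norm_sinhQuot_le hz ht
    _ = t * (Real.exp (-a * t) * Real.exp ((rootGap a b).re * t)) := by ring
    _ ≤ _ := by gcongr; exact exp_mul_exp_re_le hμ ht

/-- Serves `kerZero` with `c = a` and `kerOneDeriv` with `c = -a`. -/
lemma norm_cosh_add_mul_sinhQuot_le {a b μ t : ℝ} {c : ℂ} (hμ : (rootGap a b).re + μ ≤ a)
    (ht : 0 ≤ t) :
    ‖(Real.exp (-a * t) : ℂ) * (Complex.cosh (rootGap a b * t) + c * sinhQuot (rootGap a b) t)‖ ≤
      (1 + ‖c‖ * t) * Real.exp (-μ * t) := by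
  have hz : 0 ≤ (rootGap a b).re := by rw [rootGap_re]; positivity
  have h := exp_mul_exp_re_le hμ ht
  have h0 : ‖(Real.exp (-a * t) : ℂ)‖ = Real.exp (-a * t) := by
    rw [Complex.norm_real, Real.norm_of_nonneg (Real.exp_pos _).le]
  rw [norm_mul, h0]
  calc _ ≤ Real.exp (-a * t) * (Real.exp ((rootGap a b).re * t) +
          ‖c‖ * (t * Real.exp ((rootGap a b).re * t))) := by
        gcongr
        refine (norm_add_le _ _).trans (add_le_add (norm_cosh_mul_le hz ht) ?_)
        rw [norm_mul]
        gcongr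
        exact norm_sinhQuot_le hz ht
    _ = (1 + ‖c‖ * t) * (Real.exp (-a * t) * Real.exp ((rootGap a b).re * t)) := by ring
    _ ≤ _ := by gcongr

lemma norm_kerZero_le {a b μ t : ℝ} (ha : 0 ≤ a) (hμ : (rootGap a b).re + μ ≤ a) (ht : 0 ≤ t) :
    ‖kerZero a b t‖ ≤ (1 + a * t) * Real.exp (-μ * t) := by
  have := norm_cosh_add_mul_sinhQuot_le (c := (a : ℂ)) hμ ht
  rwa [Complex.norm_real, Real.norm_of_nonneg ha] at this

lemma norm_kerOneDeriv_le {a b μ t : ℝ} (ha : 0 ≤ a) (hμ : (rootGap a b).re + μ ≤ a)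
    (ht : 0 ≤ t) : ‖kerOneDeriv a b t‖ ≤ (1 + a * t) * Real.exp (-μ * t) := by
  have := norm_cosh_add_mul_sinhQuot_le (c := (-a : ℂ)) hμ ht
  rw [norm_neg, Complex.norm_real, Real.norm_of_nonneg ha] at this
  rwa [kerOneDeriv, sub_eq_add_neg, ← neg_mul]

/-- In the underdamped regime `rootGap` is purely imaginary and hyperbolic functions turn into
trigonometric ones. -/
lemma sinhQuot_rootGap_of_lt {a b : ℝ} (h : a ^ 2 < b) (t : ℝ) :
    sinhQuot (rootGap a b) t = (Real.sin (√(b - a ^ 2) * t) / √(b - a ^ 2) : ℝ) := by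
  have h1 : √(a ^ 2 - b) = 0 := Real.sqrt_eq_zero_of_nonpos (by linarith)
  have h2 : 0 < √(b - a ^ 2) := Real.sqrt_pos.2 (by linarith)
  have h3 : ((√(b - a ^ 2) : ℝ) : ℂ) ≠ 0 := by exact_mod_cast h2.ne'
  have h4 : rootGap a b = (√(b - a ^ 2) : ℝ) * Complex.I := by simp [rootGap, h1]
  rw [sinhQuot, h4, if_neg (mul_ne_zero h3 Complex.I_ne_zero)]
  rw [show ((√(b - a ^ 2) : ℝ) : ℂ) * Complex.I * t = (√(b - a ^ 2) * t : ℝ) * Complex.I by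
    push_cast; ring, Complex.sinh_mul_I, mul_div_mul_right _ _ Complex.I_ne_zero]
  push_cast; rfl

lemma cosh_rootGap_of_lt {a b : ℝ} (h : a ^ 2 < b) (t : ℝ) :
    Complex.cosh (rootGap a b * t) = (Real.cos (√(b - a ^ 2) * t) : ℝ) := by
  have h1 : √(a ^ 2 - b) = 0 := Real.sqrt_eq_zero_of_nonpos (by linarith)
  have h4 : rootGap a b = (√(b - a ^ 2) : ℝ) * Complex.I := by simp [rootGap, h1]
  rw [h4, show ((√(b - a ^ 2) : ℝ) : ℂ) * Complex.I * t = (√(b - a ^ 2) * t : ℝ) * Complex.I by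
    push_cast; ring, Complex.cosh_mul_I]
  push_cast; rfl

lemma measurable_sinhQuot (t : ℝ) : Measurable fun z : ℂ => sinhQuot z t := by
  unfold sinhQuot
  refine Measurable.ite (measurableSet_singleton 0) measurable_const ?_
  exact (Complex.measurable_sinh.comp (measurable_id.mul_const _)).div measurable_id

lemma measurable_rootGap {α : Type*} [MeasurableSpace α] {a b : α → ℝ} (ha : Measurable a)
    (hb : Measurable b) : Measurable fun x => rootGap (a x) (b x) := by
  unfold rootGap
  fun_prop

lemma measurable_kerOne {α : Type*} [MeasurableSpace α] {a b : α → ℝ} (ha : Measurable a)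
    (hb : Measurable b) (t : ℝ) : Measurable fun x => kerOne (a x) (b x) t := by
  have := (measurable_sinhQuot t).comp (measurable_rootGap ha hb)
  unfold kerOne
  exact (by fun_prop : Measurable fun x => ((Real.exp (-a x * t) : ℝ) : ℂ)).mul this

lemma measurable_kerZero {α : Type*} [MeasurableSpace α] {a b : α → ℝ} (ha : Measurable a)
    (hb : Measurable b) (t : ℝ) : Measurable fun x => kerZero (a x) (b x) t := by
  have h := (measurable_sinhQuot t).comp (measurable_rootGap ha hb)
  have h' := Complex.measurable_cosh.comp ((measurable_rootGap ha hb).mul_const (t : ℂ))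
  unfold kerZero
  exact (by fun_prop : Measurable fun x => ((Real.exp (-a x * t) : ℝ) : ℂ)).mul
    (h'.add ((Complex.measurable_ofReal.comp ha).mul h))

lemma measurable_kerOneDeriv {α : Type*} [MeasurableSpace α] {a b : α → ℝ} (ha : Measurable a)
    (hb : Measurable b) (t : ℝ) : Measurable fun x => kerOneDeriv (a x) (b x) t := by
  have h := (measurable_sinhQuot t).comp (measurable_rootGap ha hb)
  have h' := Complex.measurable_cosh.comp ((measurable_rootGap ha hb).mul_const (t : ℂ))
  unfold kerOneDeriv
  exact (by fun_prop : Measurable fun x => ((Real.exp (-a x * t) : ℝ) : ℂ)).mul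
    (h'.sub ((Complex.measurable_ofReal.comp ha).mul h))

end kernels

/-! ### Dominated convergence and differentiation in `L²`. -/

section Lebesgue

variable {α ι : Type*} [MeasurableSpace α] {μ : Measure α}

lemma eLpNorm_two_eq (F : α → ℂ) : eLpNorm F 2 μ = (∫⁻ x, ‖F x‖ₑ ^ 2 ∂μ) ^ (1 / 2 : ℝ) := by
  rw [eLpNorm_eq_lintegral_rpow_enorm_toReal two_ne_zero ENNReal.ofNat_ne_top]
  simp

lemma tendsto_eLpNorm_two_zero_of_dominated {l : Filter ι} [l.IsCountablyGenerated]
    {F : ι → α → ℂ} {g : α → ℝ} (hg : MemLp g 2 μ)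
    (hF : ∀ᶠ i in l, AEStronglyMeasurable (F i) μ)
    (hb : ∀ᶠ i in l, ∀ᵐ x ∂μ, ‖F i x‖ ≤ g x)
    (hlim : ∀ᵐ x ∂μ, Tendsto (fun i => F i x) l (nhds 0)) :
    Tendsto (fun i => eLpNorm (F i) 2 μ) l (nhds 0) := by
  have hfin : ∫⁻ x, ‖g x‖ₑ ^ 2 ∂μ ≠ ⊤ := by
    have := hg.eLpNorm_lt_top
    rw [eLpNorm_lt_top_iff_lintegral_rpow_enorm_lt_top two_ne_zero ENNReal.ofNat_ne_top] at this
    simpa using this.ne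
  have key : Tendsto (fun i => ∫⁻ x, ‖F i x‖ₑ ^ 2 ∂μ) l (nhds (∫⁻ _, 0 ∂μ)) := by
    refine tendsto_lintegral_filter_of_dominated_convergence' (fun x => ‖g x‖ₑ ^ 2)
      (hF.mono fun i hi => hi.enorm.pow_const 2) ?_ hfin ?_
    · filter_upwards [hb] with i hi
      filter_upwards [hi] with x hx
      gcongr
      refine enorm_le_iff_norm_le.2 (hx.trans (le_abs_self _))
    · filter_upwards [hlim] with x hx
      have := (ENNReal.continuous_pow 2).tendsto _ |>.comp hx.enorm
      simpa [Function.comp_def] using this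
  simp only [lintegral_zero] at key
  simp_rw [eLpNorm_two_eq]
  have := (ENNReal.continuous_rpow_const (y := 1 / 2)).tendsto 0 |>.comp key
  simpa [Function.comp_def] using this

/-- By the mean value inequality on the convex set `S`, difference quotients inherit the bound `g`
of the derivative. Their distance to the derivative is then at most `2g`, and pointwise convergence
upgrades to `L²`. -/
lemma hasDerivWithinAt_Lp_of_dominated {S : Set ℝ} (hS : Convex ℝ S) {f : ℝ → Lp ℂ 2 μ}
    {F F' : ℝ → α → ℂ} {g : α → ℝ} (hg : MemLp g 2 μ) (hf : ∀ t ∈ S, f t =ᵐ[μ] F t)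
    (hF : ∀ t ∈ S, ∀ x, HasDerivWithinAt (fun τ => F τ x) (F' t x) S t)
    (hb : ∀ t ∈ S, ∀ x, ‖F' t x‖ ≤ g x) {t : ℝ} (ht : t ∈ S) {f' : Lp ℂ 2 μ}
    (hf' : f' =ᵐ[μ] F' t) : HasDerivWithinAt f f' S t := by
  rw [hasDerivWithinAt_iff_tendsto_slope, Lp.tendsto_Lp_iff_tendsto_eLpNorm']
  have hcongr : ∀ τ ∈ S, ⇑(slope f t τ - f') =ᵐ[μ] fun x => slope (fun τ => F τ x) t τ - F' t x := by
    intro τ hτ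
    rw [slope_def_module]
    filter_upwards [Lp.coeFn_sub ((τ - t)⁻¹ • (f τ - f t)) f',
      Lp.coeFn_smul (τ - t)⁻¹ (f τ - f t), Lp.coeFn_sub (f τ) (f t), hf τ hτ, hf t ht, hf']
      with x h1 h2 h3 h4 h5 h6
    rw [h1, Pi.sub_apply, h2, Pi.smul_apply, h3, Pi.sub_apply, h4, h5, h6, slope_def_module]
  have hmem : ∀ᶠ τ in nhdsWithin t (S \ {t}), τ ∈ S ∧ τ ≠ t :=
    eventually_nhdsWithin_of_forall fun τ hτ => hτ
  have hlim := tendsto_eLpNorm_two_zero_of_dominated (μ := μ) (l := nhdsWithin t (S \ {t}))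
    (F := fun τ x => slope (fun τ => F τ x) t τ - F' t x) (hg.const_mul 2) ?_ ?_ ?_
  · refine hlim.congr' ?_
    filter_upwards [hmem] with τ hτ
    exact eLpNorm_congr_ae ((hcongr τ hτ.1).symm.trans (Lp.coeFn_sub _ _))
  · filter_upwards [hmem] with τ hτ
    exact (Lp.aestronglyMeasurable _).congr (hcongr τ hτ.1)
  · filter_upwards [hmem] with τ hτ
    refine ae_of_all _ fun x => ?_
    have h1 : ‖F τ x - F t x‖ ≤ g x * ‖τ - t‖ :=
      hS.norm_image_sub_le_of_norm_hasDerivWithin_le (f := fun τ => F τ x)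
        (fun y hy => hF y hy x) (fun y hy => hb y hy x) ht hτ.1
    have h2 : 0 < ‖τ - t‖ := norm_pos_iff.2 (sub_ne_zero.2 hτ.2)
    have h3 : ‖slope (fun τ => F τ x) t τ‖ ≤ g x := by
      rw [slope_def_module, norm_smul, norm_inv, inv_mul_le_iff₀ h2]
      linarith
    calc _ ≤ ‖slope (fun τ => F τ x) t τ‖ + ‖F' t x‖ := norm_sub_le _ _
      _ ≤ _ := by linarith [hb t ht x]
  · refine ae_of_all _ fun x => ?_
    have := (hasDerivWithinAt_iff_tendsto_slope.1 (hF t ht x)).sub_const (F' t x)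
    simpa using this

end Lebesgue

/-! ### The `L²` Fourier transform in angular frequency, and Sobolev membership. -/

section Fourier

variable {n : ℕ}

local notation "E" => EuclideanSpace ℝ (Fin n)

/-- The modulus of the angular frequency of the character `x ↦ e^{2πi x·η}`. -/
def freq (η : E) : ℝ := ‖(2 * Real.pi) • η‖

lemma freq_nonneg (η : E) : 0 ≤ freq η := norm_nonneg _

lemma continuous_freq : Continuous (freq (n := n)) := by unfold freq; fun_prop

lemma measurable_freq : Measurable (freq (n := n)) := continuous_freq.measurable

lemma freq_eq (η : E) : freq η = 2 * Real.pi * ‖η‖ := by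
  rw [freq, norm_smul, Real.norm_of_nonneg (by positivity)]

lemma fourierHat_smul (f : L2 n) (η : E) :
    fourierHat f ((2 * Real.pi) • η) = (𝓕 f : L2 n) η := by
  rw [fourierHat, smul_smul, inv_mul_cancel₀ (by positivity), one_smul]

/-- An `L²` representative of the rescaled symbol certifies that the default value `0` of
`invFourier` is not taken. -/
lemma invFourier_eq {m : E → ℂ} {G : L2 n} (hG : G =ᵐ[volume] fun η => m ((2 * Real.pi) • η)) :
    invFourier m = 𝓕⁻ G := by
  have h : MemLp (fun η : E => m ((2 * Real.pi) • η)) 2 volume :=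
    (memLp_congr_ae hG).1 (Lp.memLp G)
  rw [invFourier, dif_pos h]
  congr 1
  exact Lp.ext (h.coeFn_toLp.trans hG.symm)

lemma absD_eq {s : ℝ} {f G : L2 n}
    (hG : G =ᵐ[volume] fun η => ((freq η ^ s : ℝ) : ℂ) * (𝓕 f : L2 n) η) : absD s f = 𝓕⁻ G := by
  refine invFourier_eq (hG.trans (ae_of_all _ fun η => ?_))
  simp only [fourierHat_smul]; rfl

lemma norm_fourierInv_eq (f : L2 n) : ‖(𝓕⁻ f : L2 n)‖ = ‖f‖ :=
  (Lp.fourierTransformₗᵢ E ℂ).symm.norm_map f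

lemma fourierInv_inner (f g : L2 n) : inner ℂ (𝓕⁻ f : L2 n) g = inner ℂ f (𝓕 g : L2 n) := by
  have h : (𝓕 (𝓕⁻ f : L2 n) : L2 n) = f := FourierTransform.fourier_fourierInv_eq f
  rw [← Lp.inner_fourier_eq, h]

lemma fourierInv_hasDerivAt {f : ℝ → L2 n} {f' : L2 n} {t : ℝ} (h : HasDerivAt f f' t) :
    HasDerivAt (fun τ => (𝓕⁻ (f τ) : L2 n)) (𝓕⁻ f') t :=
  (((Lp.fourierTransformₗᵢ E ℂ).symm.toContinuousLinearEquiv.toContinuousLinearMap.restrictScalars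
    ℝ).hasFDerivAt.comp_hasDerivAt t h)

/-- The weight `(1 + ‖η‖²)^{s/2}` is at most `2^{s/2}(1 + freq η ^ s)`, since `‖η‖ ≤ freq η`; so it
is enough to control the homogeneous weight. -/
lemma memH_of_memLp {s : ℝ} (hs : 0 ≤ s) {f : L2 n}
    (hf : MemLp (fun η => ((freq η ^ s : ℝ) : ℂ) * (𝓕 f : L2 n) η) 2 volume) : MemH s f := by
  rw [MemH, TemperedDistribution.memSobolev_iff_exists_smulLeftCLM_fourier]
  have hw : MemLp (fun η : E => (((1 + ‖η‖ ^ 2) ^ (s / 2) : ℝ) : ℂ) * (𝓕 f : L2 n) η) 2 volume := by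
    have hsum := ((Lp.memLp (𝓕 f : L2 n)).norm.add hf.norm).const_mul ((2 : ℝ) ^ (s / 2))
    refine MemLp.mono' hsum ?_ (ae_of_all _ fun η => ?_)
    · refine AEStronglyMeasurable.mul ?_ (Lp.aestronglyMeasurable _)
      exact (by fun_prop : Measurable fun η : E => (((1 + ‖η‖ ^ 2) ^ (s / 2) : ℝ) : ℂ)).aestronglyMeasurable
    · have h1 : ‖η‖ ≤ freq η := by
        rw [freq_eq]
        nlinarith [norm_nonneg η, Real.pi_gt_three]
      have h2 : (1 + ‖η‖ ^ 2) ^ (s / 2) ≤ 2 ^ (s / 2) * (1 + freq η ^ s) := by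
        have h3 : (freq η ^ 2) ^ (s / 2) = freq η ^ s := by
          rw [← Real.rpow_natCast, ← Real.rpow_mul (freq_nonneg η)]
          congr 1; push_cast; ring
        have h4 : ‖η‖ ^ 2 ≤ freq η ^ 2 := by gcongr
        have h5 : 0 ≤ freq η ^ s := Real.rpow_nonneg (freq_nonneg η) s
        rcases le_total (freq η ^ 2) 1 with h | h
        · calc (1 + ‖η‖ ^ 2) ^ (s / 2) ≤ 2 ^ (s / 2) := by gcongr; linarith
            _ ≤ _ := le_mul_of_one_le_right (by positivity) (by linarith)
        · calc (1 + ‖η‖ ^ 2) ^ (s / 2) ≤ (2 * freq η ^ 2) ^ (s / 2) := by gcongr; linarith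
            _ = 2 ^ (s / 2) * freq η ^ s := by rw [Real.mul_rpow (by norm_num) (by positivity), h3]
            _ ≤ _ := by gcongr; linarith
      rw [norm_mul, Complex.norm_real, Real.norm_of_nonneg (by positivity)]
      simp only [Pi.add_apply, norm_mul, Complex.norm_real,
        Real.norm_of_nonneg (Real.rpow_nonneg (freq_nonneg η) s)]
      calc _ ≤ (2 ^ (s / 2) * (1 + freq η ^ s)) * ‖(𝓕 f : L2 n) η‖ := by gcongr
        _ = _ := by ring
  refine ⟨hw.toLp, ?_⟩
  ext φ
  rw [TemperedDistribution.smulLeftCLM_apply_apply, Lp.fourier_toTemperedDistribution_eq,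
    Lp.toTemperedDistribution_apply, Lp.toTemperedDistribution_apply]
  refine integral_congr_ae ?_
  filter_upwards [hw.coeFn_toLp] with η hη
  rw [hη, SchwartzMap.smulLeftCLM_apply_apply
    (by fun_prop : Function.HasTemperateGrowth fun x : E => (((1 + ‖x‖ ^ 2) ^ (s / 2) : ℝ) : ℂ))]
  simp only [smul_eq_mul]
  ring

/-- On `L¹ ∩ L²` the `L²` Fourier transform is the Fourier integral. -/
lemma fourier_ae_eq_integral {f : L2 n} (hf : Integrable f volume) :
    (𝓕 f : L2 n) =ᵐ[volume] 𝓕 (f : E → ℂ) := by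
  have hcont : Continuous (𝓕 (f : E → ℂ)) := by
    exact VectorFourier.fourierIntegral_continuous Real.continuous_fourierChar
      (by exact continuous_inner) hf
  -- Against a smooth compactly supported `φ`, both transforms pair to `∫ 𝓕 φ · f`: one by the
  -- definition of the distributional transform, the other by the exchange formula for Fourier
  -- integrals.
  refine ae_eq_of_integral_contDiff_smul_eq ((Lp.memLp _).locallyIntegrable (by norm_num))
    hcont.locallyIntegrable fun g hg hgc => ?_
  have hg₁ : HasCompactSupport (Complex.ofRealCLM ∘ g) := hgc.comp_left rfl
  have hg₂ : ContDiff ℝ ((⊤ : ℕ∞) : WithTop ℕ∞) (Complex.ofRealCLM ∘ g) := by fun_prop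
  set φ : 𝓢(E, ℂ) := hg₁.toSchwartzMap hg₂
  have h1 : ∫ x, g x • (𝓕 f : L2 n) x = ((𝓕 f : L2 n) : 𝓢'(E, ℂ)) φ := by
    rw [Lp.toTemperedDistribution_apply]; rfl
  have h2 : ∫ x, g x • 𝓕 (f : E → ℂ) x = ∫ x, φ x • 𝓕 (f : E → ℂ) x := rfl
  rw [h1, h2, ← Lp.fourier_toTemperedDistribution_eq, TemperedDistribution.fourier_apply,
    Lp.toTemperedDistribution_apply]
  have := VectorFourier.integral_fourierIntegral_smul_eq_flip (L := innerₗ E)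
    Real.continuous_fourierChar continuous_inner (μ := volume) (ν := volume) φ.integrable hf
  rwa [flip_innerₗ] at this

end Fourier

/-! ### From the distributional equation to an a.e. identity in frequency. -/

section duality

lemma eq_of_hasDerivWithinAt_zero {F : Type*} [NormedAddCommGroup F] [NormedSpace ℝ F] {f : ℝ → F}
    (hf : ∀ t, 0 ≤ t → HasDerivWithinAt f 0 (Set.Ici 0) t) {t : ℝ} (ht : 0 ≤ t) : f t = f 0 :=
  constant_of_has_deriv_right_zero
    (fun x hx => ((hf x hx.1).continuousWithinAt).mono fun _ hy => hy.1)
    (fun x hx => (hf x hx.1).mono (Set.Ici_subset_Ici.2 hx.1)) t (Set.right_mem_Icc.2 ht)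

/-- Twice integrated form of the scalar equation `p'' + b + q' = 0`. -/
lemma integrated_equation {p p' p'' q q' b Q B₁ B₂ : ℝ → ℂ}
    (hp : ∀ t, 0 ≤ t → HasDerivWithinAt p (p' t) (Set.Ici 0) t)
    (hp' : ∀ t, 0 ≤ t → HasDerivWithinAt p' (p'' t) (Set.Ici 0) t)
    (hq : ∀ t, 0 ≤ t → HasDerivWithinAt q (q' t) (Set.Ici 0) t)
    (heq : ∀ t, 0 ≤ t → p'' t + b t + q' t = 0)
    (hQ : ∀ t, 0 ≤ t → HasDerivWithinAt Q (q t) (Set.Ici 0) t)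
    (hB₁ : ∀ t, 0 ≤ t → HasDerivWithinAt B₁ (b t) (Set.Ici 0) t)
    (hB₂ : ∀ t, 0 ≤ t → HasDerivWithinAt B₂ (B₁ t) (Set.Ici 0) t)
    (hQ0 : Q 0 = 0) (hB₁0 : B₁ 0 = 0) (hB₂0 : B₂ 0 = 0) {t : ℝ} (ht : 0 ≤ t) :
    p t + Q t + B₂ t = p 0 + t * (p' 0 + q 0) := by
  -- The equation says that the left side has zero derivative. A second integration then removes
  -- `p'`, which is only known for individual test functions.
  have h1 : ∀ τ, 0 ≤ τ → p' τ + q τ + B₁ τ = p' 0 + q 0 := by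
    intro τ hτ
    have := eq_of_hasDerivWithinAt_zero (f := fun τ => p' τ + q τ + B₁ τ) (fun x hx =>
      (((hp' x hx).add (hq x hx)).add (hB₁ x hx)).congr_deriv (by linear_combination heq x hx)) hτ
    simpa [hB₁0] using this
  have h2 := eq_of_hasDerivWithinAt_zero
    (f := fun τ : ℝ => p τ + Q τ + B₂ τ - (τ : ℂ) * (p' 0 + q 0)) (fun x hx =>
      ((((hp x hx).add (hQ x hx)).add (hB₂ x hx)).sub
        ((Complex.ofRealCLM.hasDerivAt (x := x)).hasDerivWithinAt.mul_const
          (p' 0 + q 0))).congr_deriv (by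
        simp only [Complex.ofRealCLM_apply, Complex.ofReal_one]
        linear_combination h1 x hx)) ht
  simp only [hQ0, hB₂0, Complex.ofReal_zero, zero_mul, add_zero, sub_zero] at h2
  linear_combination h2

variable {n : ℕ}

local notation "E" => EuclideanSpace ℝ (Fin n)

lemma measurable_freq_rpow (k : ℝ) : Measurable fun η : E => freq η ^ k :=
  measurable_freq.pow_const k

lemma continuous_freq_rpow {k : ℝ} (hk : 0 ≤ k) : Continuous fun η : E => freq η ^ k :=
  continuous_freq.rpow_const fun _ => Or.inr hk

lemma freq_rpow_nonneg (k : ℝ) (η : E) : 0 ≤ freq η ^ k := Real.rpow_nonneg (freq_nonneg η) k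

section testing

/-- Meant for `|ξ|^k g`, which may fail to be smooth at the origin and so need not be a Schwartz
function. -/
lemma exists_testL2 {w : E → ℝ} (hw : Continuous w) (hc : HasCompactSupport w) :
    ∃ W : L2 n, W =ᵐ[volume] fun η => (w η : ℂ) := by
  have h : MemLp (fun η => (w η : ℂ)) 2 (volume : Measure E) :=
    (Complex.continuous_ofReal.comp hw).memLp_of_hasCompactSupport
      (hc.comp_left (g := Complex.ofReal) Complex.ofReal_zero)
  exact ⟨h.toLp, h.coeFn_toLp⟩

/-- The weight is real, so the conjugation in the first slot of the inner product disappears. -/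
lemma inner_eq_integral_smul {w : E → ℝ} {W : L2 n} (hW : W =ᵐ[volume] fun η => (w η : ℂ))
    (v : L2 n) : inner ℂ W v = ∫ η, w η • v η := by
  rw [L2.inner_def]
  refine integral_congr_ae ?_
  filter_upwards [hW] with η hη
  rw [hη]
  simp [mul_comm]

variable {σ δ : ℝ} {u₀ u₁ : L2 n} {u : ℝ → L2 n}

/-- The equation on the Fourier side, integrated twice in time. -/
lemma IsSolution.integrated (h : IsSolution σ δ u₀ u₁ u) (hσ : 0 ≤ σ) (hδ : 0 ≤ δ)
    {I₁ I₂ : ℝ → L2 n}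
    (hI₁ : ∀ t, 0 ≤ t → HasDerivWithinAt I₁ (𝓕 (u t)) (Set.Ici 0) t)
    (hI₂ : ∀ t, 0 ≤ t → HasDerivWithinAt I₂ (I₁ t) (Set.Ici 0) t)
    (hI₁0 : I₁ 0 = 0) (hI₂0 : I₂ 0 = 0) {t : ℝ} (ht : 0 ≤ t) :
    ∀ᵐ η, (𝓕 (u t) : L2 n) η + (freq η ^ (2 * δ)) • I₁ t η + (freq η ^ (2 * σ)) • I₂ t η =
      (𝓕 u₀ : L2 n) η + t • ((𝓕 u₁ : L2 n) η + (freq η ^ (2 * δ)) • (𝓕 u₀ : L2 n) η) := by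
  have hloc : ∀ v : L2 n, LocallyIntegrable v volume := fun v =>
    (Lp.memLp v).locallyIntegrable (by norm_num)
  have hlock : ∀ (v : L2 n) {k : ℝ}, 0 ≤ k →
      LocallyIntegrable (fun η => (freq η ^ k) • v η) volume := fun v k hk => by
    exact locallyIntegrableOn_univ.1 ((locallyIntegrableOn_univ.2 (hloc v)).continuousOn_smul
      isClosed_univ.isLocallyClosed (continuous_freq_rpow hk).continuousOn)
  refine ae_eq_of_integral_contDiff_smul_eq
    (((hloc _).add (hlock _ (by linarith))).add (hlock _ (by linarith)))
    ((hloc _).add (((hloc _).add (hlock _ (by linarith))).smul t)) fun g hg hgc => ?_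
  have hg₁ : HasCompactSupport (Complex.ofRealCLM ∘ g) := hgc.comp_left rfl
  have hg₂ : ContDiff ℝ ((⊤ : ℕ∞) : WithTop ℕ∞) (Complex.ofRealCLM ∘ g) := by fun_prop
  set ψ : 𝓢(E, ℂ) := hg₁.toSchwartzMap hg₂ with hψ
  have hψW : (ψ.toLp 2 : L2 n) =ᵐ[volume] fun η => (g η : ℂ) := ψ.coeFn_toLp 2 volume
  have hweight : ∀ {k : ℝ}, 0 ≤ k → ∃ W : L2 n, W =ᵐ[volume] fun η => ((freq η ^ k * g η : ℝ) : ℂ) :=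
    fun hk => exists_testL2 ((continuous_freq_rpow hk).mul hg.continuous) hgc.mul_left
  obtain ⟨Wδ, hWδ⟩ := hweight (k := 2 * δ) (by linarith)
  obtain ⟨Wσ, hWσ⟩ := hweight (k := 2 * σ) (by linarith)
  have hφ : ((𝓕⁻ ψ : 𝓢(E, ℂ)).toLp 2 : L2 n) = 𝓕⁻ (ψ.toLp 2 : L2 n) :=
    (SchwartzMap.toLp_fourierInv_eq ψ).symm
  have hfrac : ∀ {k : ℝ} {W : L2 n}, W =ᵐ[volume] (fun η => ((freq η ^ (2 * k) * g η : ℝ) : ℂ)) →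
      fracLaplacian k ((𝓕⁻ ψ : 𝓢(E, ℂ)).toLp 2 : L2 n) = 𝓕⁻ W := by
    intro k W hW
    refine absD_eq ?_
    have h1 : (𝓕 (𝓕⁻ (ψ.toLp 2 : L2 n) : L2 n) : L2 n) = ψ.toLp 2 :=
      FourierTransform.fourier_fourierInv_eq _
    rw [hφ, h1]
    filter_upwards [hW, hψW] with η h2 h3
    rw [h2, h3]; push_cast; rfl
  -- Testing with `𝓕⁻ ψ` amounts to testing with `g` in frequency; by `hfrac` the fractional
  -- Laplacians only multiply `g` by powers of `freq`.
  obtain ⟨p', p'', q', hp0, heq⟩ := h.equation (𝓕⁻ ψ)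
  rw [hfrac hWδ, hfrac hWσ, hφ] at heq
  rw [hφ] at hp0
  simp only [fourierInv_inner] at heq hp0
  have hder : ∀ (W : L2 n) {J J' : ℝ → L2 n},
      (∀ t, 0 ≤ t → HasDerivWithinAt J (J' t) (Set.Ici 0) t) → ∀ t, 0 ≤ t →
      HasDerivWithinAt (fun τ => inner ℂ W (J τ)) (inner ℂ W (J' t)) (Set.Ici 0) t :=
    fun W J J' hJ t ht =>
      (((innerSL ℂ W).restrictScalars ℝ).hasFDerivAt.comp_hasDerivWithinAt t (hJ t ht))
  have key := integrated_equation (fun t ht => (heq t ht).1) (fun t ht => (heq t ht).2.1)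
    (fun t ht => (heq t ht).2.2.1) (fun t ht => (heq t ht).2.2.2) (hder Wδ hI₁) (hder Wσ hI₁)
    (hder Wσ hI₂) (by simp [hI₁0]) (by simp [hI₁0]) (by simp [hI₂0]) ht
  rw [hp0, h.initial] at key
  simp only [inner_eq_integral_smul hψW, inner_eq_integral_smul hWδ, inner_eq_integral_smul hWσ]
    at key
  have hint : ∀ v : E → ℂ, LocallyIntegrable v volume → Integrable (fun η => g η • v η) volume :=
    fun v hv => hv.integrable_smul_left_of_hasCompactSupport hg.continuous hgc
  have hcomm : ∀ (k : ℝ) (v : E → ℂ), ∫ η, (freq η ^ k * g η) • v η = ∫ η, g η • (freq η ^ k) • v η :=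
    fun k v => integral_congr_ae (ae_of_all _ fun η => by
      simp only [mul_comm (freq η ^ k), mul_smul])
  simp only [hcomm] at key
  have hladd : ∀ {v w : E → ℂ}, LocallyIntegrable v volume → LocallyIntegrable w volume →
      LocallyIntegrable (fun η => v η + w η) volume := fun hv hw => hv.add hw
  have hadd : ∀ {v w : E → ℂ}, LocallyIntegrable v volume → LocallyIntegrable w volume →
      ∫ η, g η • (v η + w η) = (∫ η, g η • v η) + ∫ η, g η • w η := fun hv hw => by
    simp only [smul_add]
    exact integral_add (hint _ hv) (hint _ hw)
  have hsmul : ∀ v : E → ℂ, ∫ η, g η • t • v η = t * ∫ η, g η • v η := fun v => by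
    rw [← Complex.real_smul, ← integral_smul]
    exact integral_congr_ae (ae_of_all _ fun η => smul_comm _ _ _)
  have hδ' : 0 ≤ 2 * δ := by linarith
  have hσ' : 0 ≤ 2 * σ := by linarith
  have hsum : LocallyIntegrable (fun η => t • ((𝓕 u₁ : L2 n) η +
      (freq η ^ (2 * δ)) • (𝓕 u₀ : L2 n) η)) volume := (hladd (hloc (𝓕 u₁)) (hlock (𝓕 u₀) hδ')).smul t
  rw [hadd (hladd (hloc (𝓕 (u t))) (hlock (I₁ t) hδ')) (hlock (I₂ t) hσ'),
    hadd (hloc (𝓕 (u t))) (hlock (I₁ t) hδ'), key, hadd (hloc (𝓕 u₀)) hsum,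
    hsmul, hadd (hloc (𝓕 u₁)) (hlock (𝓕 u₀) hδ')]

end testing

end duality

/-! ### Uniqueness: every solution is the explicit one. -/

section representation

/-- As a first-order system on `H × H` the equation has a bounded, hence Lipschitz, generator. This
is why the unbounded symbols must first be cut off. -/
lemma secondOrder_unique {H : Type*} [NormedAddCommGroup H] [NormedSpace ℝ H] (A B : H →L[ℝ] H)
    {T : ℝ} {f f' g g' : ℝ → H}
    (hf : ∀ t ∈ Set.Icc 0 T, HasDerivWithinAt f (f' t) (Set.Icc 0 T) t)
    (hf' : ∀ t ∈ Set.Icc 0 T, HasDerivWithinAt f' (-A (f' t) - B (f t)) (Set.Icc 0 T) t)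
    (hg : ∀ t ∈ Set.Icc 0 T, HasDerivWithinAt g (g' t) (Set.Icc 0 T) t)
    (hg' : ∀ t ∈ Set.Icc 0 T, HasDerivWithinAt g' (-A (g' t) - B (g t)) (Set.Icc 0 T) t)
    (h0 : f 0 = g 0) (h0' : f' 0 = g' 0) : Set.EqOn f g (Set.Icc 0 T) := by
  let L : H × H →L[ℝ] H × H :=
    (ContinuousLinearMap.snd ℝ H H).prod
      (-(A.comp (ContinuousLinearMap.snd ℝ H H)) - B.comp (ContinuousLinearMap.fst ℝ H H))
  have hmono : ∀ t ∈ Set.Ico 0 T, Set.Icc 0 T ∈ nhdsWithin t (Set.Ici t) := fun t ht =>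
    Icc_mem_nhdsGE_of_mem ht
  have := ODE_solution_unique (v := fun _ => L) (K := ‖L‖₊) (a := 0) (b := T)
    (f := fun t => (f t, f' t)) (g := fun t => (g t, g' t)) (fun _ => L.lipschitz)
    (fun t ht => ((hf t ht).prodMk (hf' t ht)).continuousWithinAt)
    (fun t ht => ((hf t ⟨ht.1, ht.2.le⟩).prodMk (hf' t ⟨ht.1, ht.2.le⟩)).mono_of_mem_nhdsWithin
      (hmono t ht))
    (fun t ht => ((hg t ht).prodMk (hg' t ht)).continuousWithinAt)
    (fun t ht => ((hg t ⟨ht.1, ht.2.le⟩).prodMk (hg' t ⟨ht.1, ht.2.le⟩)).mono_of_mem_nhdsWithin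
      (hmono t ht)) (by simp [h0, h0'])
  exact fun t ht => (Prod.ext_iff.1 (this ht)).1

variable {n : ℕ}

local notation "E" => EuclideanSpace ℝ (Fin n)

/-- The multiplier `|ξ|^k` cut off at `|ξ| ≤ R`. -/
def cutWeight (R k : ℝ) (η : E) : ℂ := if freq η ≤ R then ((freq η ^ k : ℝ) : ℂ) else 0

lemma measurable_cutWeight (R k : ℝ) : Measurable (cutWeight (n := n) R k) :=
  Measurable.ite (measurableSet_le measurable_freq measurable_const)
    (Complex.measurable_ofReal.comp (measurable_freq_rpow k)) measurable_const

lemma norm_cutWeight_le {R k : ℝ} (hR : 0 ≤ R) (hk : 0 ≤ k) (η : E) : ‖cutWeight R k η‖ ≤ R ^ k := by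
  unfold cutWeight
  split_ifs with h
  · rw [Complex.norm_real, Real.norm_of_nonneg (freq_rpow_nonneg k η)]
    exact Real.rpow_le_rpow (freq_nonneg η) h hk
  · rw [norm_zero]; positivity

lemma exists_cutMul {R k : ℝ} (hR : 0 ≤ R) (hk : 0 ≤ k) :
    ∃ A : L2 n →L[ℝ] L2 n, ∀ f : L2 n, A f =ᵐ[volume] fun η => cutWeight R k η * f η := by
  have h : MemLp (cutWeight (n := n) R k) ⊤ volume :=
    memLp_top_of_bound (measurable_cutWeight R k).aestronglyMeasurable (R ^ k)
      (ae_of_all _ (norm_cutWeight_le hR hk))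
  refine ⟨((ContinuousLinearMap.mul ℂ ℂ).holderL volume ⊤ 2 2 h.toLp).restrictScalars ℝ,
    fun f => ?_⟩
  refine ((ContinuousLinearMap.mul ℂ ℂ).coeFn_holder (r := 2) h.toLp f).trans ?_
  filter_upwards [h.coeFn_toLp] with η hη
  simp [hη]

section profile

variable (σ δ : ℝ) (x y : EuclideanSpace ℝ (Fin n) → ℂ)

/-- The solution with frequency side data `x`, `y`. -/
def freqSol (t : ℝ) (η : E) : ℂ :=
  kerZero (freq η ^ (2 * δ) / 2) (freq η ^ (2 * σ)) t * x η +
    kerOne (freq η ^ (2 * δ) / 2) (freq η ^ (2 * σ)) t * y η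

/-- The first time derivative of `freqSol`. -/
def freqSolDeriv (t : ℝ) (η : E) : ℂ :=
  -((freq η ^ (2 * σ) : ℝ) : ℂ) * kerOne (freq η ^ (2 * δ) / 2) (freq η ^ (2 * σ)) t * x η +
    kerOneDeriv (freq η ^ (2 * δ) / 2) (freq η ^ (2 * σ)) t * y η

lemma hasDerivAt_freqSol (t : ℝ) (η : E) :
    HasDerivAt (fun τ => freqSol σ δ x y τ η) (freqSolDeriv σ δ x y t η) t :=
  ((hasDerivAt_kerZero _ _ t).mul_const (x η)).add ((hasDerivAt_kerOne _ _ t).mul_const (y η))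

lemma hasDerivAt_freqSolDeriv (t : ℝ) (η : E) :
    HasDerivAt (fun τ => freqSolDeriv σ δ x y τ η)
      (-((freq η ^ (2 * δ) : ℝ) : ℂ) * freqSolDeriv σ δ x y t η -
        ((freq η ^ (2 * σ) : ℝ) : ℂ) * freqSol σ δ x y t η) t := by
  refine ((((hasDerivAt_kerOne _ _ t).const_mul (-((freq η ^ (2 * σ) : ℝ) : ℂ))).mul_const
    (x η)).add ((hasDerivAt_kerOneDeriv _ _ t).mul_const (y η))).congr_deriv ?_
  simp only [freqSolDeriv, freqSol, kerZero, kerOne, kerOneDeriv]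
  push_cast
  ring

lemma freqSol_zero (η : E) : freqSol σ δ x y 0 η = x η := by simp [freqSol]

lemma freqSolDeriv_zero (η : E) : freqSolDeriv σ δ x y 0 η = y η := by simp [freqSolDeriv]

variable {x y}

lemma aestronglyMeasurable_freqSol (hx : AEStronglyMeasurable x volume)
    (hy : AEStronglyMeasurable y volume) (t : ℝ) :
    AEStronglyMeasurable (freqSol σ δ x y t) volume :=
  ((measurable_kerZero ((measurable_freq_rpow _).div_const 2)
      (measurable_freq_rpow _) t).aestronglyMeasurable.mul hx).add
    ((measurable_kerOne ((measurable_freq_rpow _).div_const 2)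
      (measurable_freq_rpow _) t).aestronglyMeasurable.mul hy)

lemma aestronglyMeasurable_freqSolDeriv (hx : AEStronglyMeasurable x volume)
    (hy : AEStronglyMeasurable y volume) (t : ℝ) :
    AEStronglyMeasurable (freqSolDeriv σ δ x y t) volume :=
  ((((Complex.measurable_ofReal.comp (measurable_freq_rpow _)).neg.mul
      (measurable_kerOne ((measurable_freq_rpow _).div_const 2)
      (measurable_freq_rpow _) t)).aestronglyMeasurable).mul hx).add
    ((measurable_kerOneDeriv ((measurable_freq_rpow _).div_const 2)
      (measurable_freq_rpow _) t).aestronglyMeasurable.mul hy)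

variable {σ δ} (x y)

/-- One common factor dominates both kernels, so the data enter only through `‖x η‖ + ‖y η‖`. -/
lemma norm_freqSol_le {μ t : ℝ} {η : E} (ht : 0 ≤ t)
    (hμ : (rootGap (freq η ^ (2 * δ) / 2) (freq η ^ (2 * σ))).re + μ ≤ freq η ^ (2 * δ) / 2) :
    ‖freqSol σ δ x y t η‖ ≤
      (1 + (freq η ^ (2 * δ) / 2 + 1) * t) * Real.exp (-μ * t) * (‖x η‖ + ‖y η‖) := by
  have ha : 0 ≤ freq η ^ (2 * δ) / 2 := by have := freq_rpow_nonneg (2 * δ) η; positivity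
  have h0 := norm_kerZero_le ha hμ ht
  have h1 := norm_kerOne_le hμ ht
  have he := (Real.exp_pos (-μ * t)).le
  have h0' : ‖kerZero (freq η ^ (2 * δ) / 2) (freq η ^ (2 * σ)) t‖ ≤
      (1 + (freq η ^ (2 * δ) / 2 + 1) * t) * Real.exp (-μ * t) :=
    h0.trans (by gcongr; linarith)
  have h1' : ‖kerOne (freq η ^ (2 * δ) / 2) (freq η ^ (2 * σ)) t‖ ≤
      (1 + (freq η ^ (2 * δ) / 2 + 1) * t) * Real.exp (-μ * t) :=
    h1.trans (by gcongr; nlinarith [mul_nonneg ha ht])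
  rw [freqSol, mul_add]
  refine (norm_add_le _ _).trans ?_
  rw [norm_mul, norm_mul]
  gcongr

lemma norm_freqSolDeriv_le {μ t : ℝ} {η : E} (ht : 0 ≤ t)
    (hμ : (rootGap (freq η ^ (2 * δ) / 2) (freq η ^ (2 * σ))).re + μ ≤ freq η ^ (2 * δ) / 2) :
    ‖freqSolDeriv σ δ x y t η‖ ≤ (1 + freq η ^ (2 * σ)) *
      ((1 + (freq η ^ (2 * δ) / 2 + 1) * t) * Real.exp (-μ * t) * (‖x η‖ + ‖y η‖)) := by
  have ha : 0 ≤ freq η ^ (2 * δ) / 2 := by have := freq_rpow_nonneg (2 * δ) η; positivity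
  have hb : 0 ≤ freq η ^ (2 * σ) := freq_rpow_nonneg (2 * σ) η
  have h0 := norm_kerOneDeriv_le ha hμ ht
  have h1 := norm_kerOne_le hμ ht
  have he := (Real.exp_pos (-μ * t)).le
  set M := (1 + (freq η ^ (2 * δ) / 2 + 1) * t) * Real.exp (-μ * t) with hM
  have hM0 : 0 ≤ M := by positivity
  have h0' : ‖kerOneDeriv (freq η ^ (2 * δ) / 2) (freq η ^ (2 * σ)) t‖ ≤ M :=
    h0.trans (by rw [hM]; gcongr; linarith)
  have h1' : ‖kerOne (freq η ^ (2 * δ) / 2) (freq η ^ (2 * σ)) t‖ ≤ M :=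
    h1.trans (by rw [hM]; gcongr; nlinarith [mul_nonneg ha ht])
  rw [freqSolDeriv]
  refine (norm_add_le _ _).trans ?_
  rw [norm_mul, norm_mul, norm_mul, norm_neg, Complex.norm_real, Real.norm_of_nonneg hb]
  calc _ ≤ freq η ^ (2 * σ) * M * ‖x η‖ + M * ‖y η‖ := by gcongr
    _ ≤ _ := by
      have := mul_nonneg hM0 (norm_nonneg (x η))
      have := mul_nonneg (mul_nonneg hb hM0) (norm_nonneg (y η))
      nlinarith

end profile

variable {σ δ : ℝ} {u₀ u₁ : L2 n} {u : ℝ → L2 n}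

/-- On `freq η ≤ R` the symbols are bounded, so with `μ = 0` the explicit solution and its first two
time derivatives are dominated on `[0, T]` by multiples of `‖x η‖ + ‖y η‖`; pointwise derivatives
are then `L²` derivatives. -/
lemma exists_cut_freqSol (hσ : 0 ≤ σ) (hδ : 0 ≤ δ) {R T : ℝ} (hR : 0 ≤ R) (hT : 0 ≤ T)
    (A B : L2 n →L[ℝ] L2 n) (hA : ∀ f : L2 n, A f =ᵐ[volume] fun η => cutWeight R (2 * δ) η * f η)
    (hB : ∀ f : L2 n, B f =ᵐ[volume] fun η => cutWeight R (2 * σ) η * f η) (x y : L2 n) :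
    ∃ S S' : ℝ → L2 n,
      (∀ t ∈ Set.Icc 0 T, S t =ᵐ[volume] fun η => cutWeight R 0 η * freqSol σ δ x y t η) ∧
      (∀ t ∈ Set.Icc 0 T, S' t =ᵐ[volume] fun η => cutWeight R 0 η * freqSolDeriv σ δ x y t η) ∧
      (∀ t ∈ Set.Icc 0 T, HasDerivWithinAt S (S' t) (Set.Icc 0 T) t) ∧
      (∀ t ∈ Set.Icc 0 T, HasDerivWithinAt S' (-A (S' t) - B (S t)) (Set.Icc 0 T) t) := by
  set a := R ^ (2 * δ) with ha
  set b := R ^ (2 * σ) with hb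
  have ha0 : 0 ≤ a := by positivity
  have hb0 : 0 ≤ b := by positivity
  set M := 1 + (a / 2 + 1) * T with hM
  have hM0 : 0 ≤ M := by positivity
  have hxy : MemLp (fun η => ‖x η‖ + ‖y η‖) 2 (volume : Measure E) :=
    (Lp.memLp x).norm.add (Lp.memLp y).norm
  have hcut : ∀ {η : E}, freq η ≤ R → freq η ^ (2 * δ) ≤ a ∧ freq η ^ (2 * σ) ≤ b := fun h =>
    ⟨Real.rpow_le_rpow (freq_nonneg _) h (by linarith),
      Real.rpow_le_rpow (freq_nonneg _) h (by linarith)⟩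
  have hgap : ∀ η : E,
      (rootGap (freq η ^ (2 * δ) / 2) (freq η ^ (2 * σ))).re + 0 ≤ freq η ^ (2 * δ) / 2 := fun η => by
    rw [add_zero]
    exact rootGap_re_le (div_nonneg (freq_rpow_nonneg _ η) two_pos.le) (freq_rpow_nonneg _ η)
  have b0 : ∀ t ∈ Set.Icc 0 T, ∀ η : E, freq η ≤ R →
      ‖freqSol σ δ x y t η‖ ≤ M * (‖x η‖ + ‖y η‖) := by
    intro t ht η h
    refine (norm_freqSol_le x y ht.1 (hgap η)).trans ?_
    have := ht.1
    rw [neg_zero, zero_mul, Real.exp_zero, mul_one, hM]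
    gcongr
    exacts [(hcut h).1, ht.2]
  have b1 : ∀ t ∈ Set.Icc 0 T, ∀ η : E, freq η ≤ R →
      ‖freqSolDeriv σ δ x y t η‖ ≤ (1 + b) * (M * (‖x η‖ + ‖y η‖)) := by
    intro t ht η h
    refine (norm_freqSolDeriv_le x y ht.1 (hgap η)).trans ?_
    have := ht.1
    have := freq_rpow_nonneg (2 * δ) η
    rw [neg_zero, zero_mul, Real.exp_zero, mul_one, hM]
    gcongr
    exacts [(hcut h).2, (hcut h).1, ht.2]
  have hcw : ∀ (k : ℝ) {η : E}, ¬ freq η ≤ R → cutWeight R k η = 0 := fun k η h => if_neg h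
  have hcw0 : ∀ {η : E}, freq η ≤ R → cutWeight R 0 η = 1 := fun h => by
    rw [cutWeight, if_pos h]; simp
  have hbound : ∀ {F : E → ℂ} {C : ℝ}, 0 ≤ C →
      (∀ η, freq η ≤ R → ‖F η‖ ≤ C * (‖x η‖ + ‖y η‖)) →
      ∀ η, ‖cutWeight R 0 η * F η‖ ≤ C * (‖x η‖ + ‖y η‖) := by
    intro F C hC h η
    by_cases hη : freq η ≤ R
    · rw [hcw0 hη, one_mul]; exact h η hη
    · rw [hcw 0 hη, zero_mul, norm_zero]; positivity
  have hex : ∀ {F : E → ℂ} {C : ℝ}, 0 ≤ C → AEStronglyMeasurable F volume →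
      (∀ η, freq η ≤ R → ‖F η‖ ≤ C * (‖x η‖ + ‖y η‖)) →
      ∃ G : L2 n, G =ᵐ[volume] fun η => cutWeight R 0 η * F η := by
    intro F C hC hF h
    have : MemLp (fun η => cutWeight R 0 η * F η) 2 volume :=
      (hxy.const_mul C).mono' ((measurable_cutWeight R 0).aestronglyMeasurable.mul hF)
        (ae_of_all _ (hbound hC h))
    exact ⟨this.toLp, this.coeFn_toLp⟩
  have h0 : ∀ t, ∃ G : L2 n, t ∈ Set.Icc 0 T →
      G =ᵐ[volume] fun η => cutWeight R 0 η * freqSol σ δ x y t η := fun t => by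
    by_cases ht : t ∈ Set.Icc 0 T
    · obtain ⟨G, hG⟩ := hex hM0 (aestronglyMeasurable_freqSol σ δ (Lp.aestronglyMeasurable x)
        (Lp.aestronglyMeasurable y) t) (b0 t ht)
      exact ⟨G, fun _ => hG⟩
    · exact ⟨0, fun h => absurd h ht⟩
  have h1 : ∀ t, ∃ G : L2 n, t ∈ Set.Icc 0 T →
      G =ᵐ[volume] fun η => cutWeight R 0 η * freqSolDeriv σ δ x y t η := fun t => by
    by_cases ht : t ∈ Set.Icc 0 T
    · obtain ⟨G, hG⟩ := hex (C := (1 + b) * M) (by positivity)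
        (aestronglyMeasurable_freqSolDeriv σ δ (Lp.aestronglyMeasurable x)
        (Lp.aestronglyMeasurable y) t) (fun η h => (b1 t ht η h).trans_eq (by ring))
      exact ⟨G, fun _ => hG⟩
    · exact ⟨0, fun h => absurd h ht⟩
  choose S hS using h0
  choose S' hS' using h1
  refine ⟨S, S', hS, hS', fun t ht => ?_, fun t ht => ?_⟩
  · exact hasDerivWithinAt_Lp_of_dominated (convex_Icc 0 T) (hxy.const_mul ((1 + b) * M)) hS
      (fun t _ η => ((hasDerivAt_freqSol σ δ x y t η).const_mul _).hasDerivWithinAt)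
      (fun t ht => hbound (by positivity) fun η h => (b1 t ht η h).trans_eq (by ring)) ht (hS' t ht)
  · refine hasDerivWithinAt_Lp_of_dominated (convex_Icc 0 T)
      (hxy.const_mul (a * ((1 + b) * M) + b * M)) hS'
      (fun t _ η => ((hasDerivAt_freqSolDeriv σ δ x y t η).const_mul _).hasDerivWithinAt)
      (fun t ht => hbound (by positivity) fun η h => ?_) ht ?_
    · refine (norm_sub_le _ _).trans ?_
      rw [norm_mul, norm_mul, norm_neg, Complex.norm_real, Complex.norm_real,
        Real.norm_of_nonneg (freq_rpow_nonneg _ η), Real.norm_of_nonneg (freq_rpow_nonneg _ η)]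
      calc _ ≤ a * ((1 + b) * (M * (‖x η‖ + ‖y η‖))) + b * (M * (‖x η‖ + ‖y η‖)) := by
            gcongr
            exacts [(hcut h).1, b1 t ht η h, (hcut h).2, b0 t ht η h]
        _ = _ := by ring
    · filter_upwards [Lp.coeFn_sub (-A (S' t)) (B (S t)), Lp.coeFn_neg (A (S' t)), hA (S' t),
        hB (S t), hS t ht, hS' t ht] with η e1 e2 e3 e4 e5 e6
      rw [e1, Pi.sub_apply, e2, Pi.neg_apply, e3, e4, e5, e6]
      by_cases hη : freq η ≤ R
      · simp only [cutWeight, if_pos hη, Real.rpow_zero, Complex.ofReal_one]; ring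
      · simp [hcw _ hη]

/-- Every solution is given on the Fourier side by the explicit kernels. -/
theorem IsSolution.fourier_eq (h : IsSolution σ δ u₀ u₁ u) (hσ : 0 ≤ σ) (hδ : 0 ≤ δ) {T : ℝ}
    (hT : 0 ≤ T) :
    (𝓕 (u T) : L2 n) =ᵐ[volume] freqSol σ δ (𝓕 u₀ : L2 n) (𝓕 u₁ : L2 n) T := by
  -- Freezing `u` at its initial value for negative times gives a continuous function on `ℝ`, whose
  -- primitives are differentiable on both sides.
  set U : ℝ → L2 n := fun τ => 𝓕 (u (max τ 0)) with hU
  have hUc : Continuous U := by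
    have h1 : Continuous fun τ : ℝ => u (max τ 0) :=
      h.continuousOn.comp_continuous (by fun_prop) fun τ => Set.mem_Ici.2 (le_max_right _ _)
    exact (Lp.fourierTransformₗᵢ E ℂ).continuous.comp h1
  have hUeq : ∀ t, 0 ≤ t → U t = 𝓕 (u t) := fun t ht => by rw [hU]; simp only [max_eq_left ht]
  set I₁ : ℝ → L2 n := fun t => ∫ τ in (0 : ℝ)..t, U τ
  set I₂ : ℝ → L2 n := fun t => ∫ τ in (0 : ℝ)..t, I₁ τ
  have hI₁ : ∀ t, HasDerivAt I₁ (U t) t := fun t => hUc.integral_hasStrictDerivAt 0 t |>.hasDerivAt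
  have hI₁c : Continuous I₁ := continuous_iff_continuousAt.2 fun t => (hI₁ t).continuousAt
  have hI₂ : ∀ t, HasDerivAt I₂ (I₁ t) t := fun t =>
    hI₁c.integral_hasStrictDerivAt 0 t |>.hasDerivAt
  have hI₁0 : I₁ 0 = 0 := intervalIntegral.integral_same
  have hI₂0 : I₂ 0 = 0 := intervalIntegral.integral_same
  have hint := fun (t : ℝ) (ht : 0 ≤ t) => h.integrated hσ hδ (I₁ := I₁) (I₂ := I₂)
    (fun t ht => hUeq t ht ▸ (hI₁ t).hasDerivWithinAt) (fun t _ => (hI₂ t).hasDerivWithinAt)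
    hI₁0 hI₂0 ht
  -- Integer cutoffs suffice and involve only countably many null sets.
  suffices key : ∀ R : ℕ, ∀ᵐ η, freq η ≤ (R : ℝ) →
      (𝓕 (u T) : L2 n) η = freqSol σ δ (𝓕 u₀ : L2 n) (𝓕 u₁ : L2 n) T η by
    filter_upwards [ae_all_iff.2 key] with η hη
    obtain ⟨R, hR⟩ := exists_nat_ge (freq η)
    exact hη R hR
  intro R
  have hR : (0 : ℝ) ≤ R := Nat.cast_nonneg R
  -- Exponent `0` makes `P` the sharp frequency projection, also at the origin, because `0 ^ 0 = 1`.
  obtain ⟨P, hP⟩ := exists_cutMul (n := n) hR (le_refl (0 : ℝ))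
  obtain ⟨A, hA⟩ := exists_cutMul (n := n) hR (by linarith : 0 ≤ 2 * δ)
  obtain ⟨B, hB⟩ := exists_cutMul (n := n) hR (by linarith : 0 ≤ 2 * σ)
  obtain ⟨S, S', hS, hS', hSd, hSd'⟩ := exists_cut_freqSol hσ hδ hR hT A B hA hB (𝓕 u₀) (𝓕 u₁)
  have hidem : ∀ (C : L2 n →L[ℝ] L2 n) (k : ℝ),
      (∀ f : L2 n, C f =ᵐ[volume] fun η => cutWeight R k η * f η) → ∀ f, C (P f) = C f := by
    intro C k hC f
    refine Lp.ext ?_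
    filter_upwards [hC (P f), hC f, hP f] with η e1 e2 e3
    rw [e1, e2, e3]
    by_cases hη : freq η ≤ R
    · simp [cutWeight, if_pos hη]
    · simp [cutWeight, if_neg hη]
  have hcutint : ∀ t, 0 ≤ t →
      P (U t) = P (𝓕 u₀) + t • (P (𝓕 u₁) + A (𝓕 u₀)) - A (I₁ t) - B (I₂ t) := by
    intro t ht
    refine Lp.ext ?_
    rw [hUeq t ht]
    filter_upwards [hint t ht, hP (𝓕 (u t)), hP (𝓕 u₀), hP (𝓕 u₁), hA (𝓕 u₀), hA (I₁ t), hB (I₂ t),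
      Lp.coeFn_sub (P (𝓕 u₀) + t • (P (𝓕 u₁) + A (𝓕 u₀)) - A (I₁ t)) (B (I₂ t)),
      Lp.coeFn_sub (P (𝓕 u₀) + t • (P (𝓕 u₁) + A (𝓕 u₀))) (A (I₁ t)),
      Lp.coeFn_add (P (𝓕 u₀)) (t • (P (𝓕 u₁) + A (𝓕 u₀))),
      Lp.coeFn_smul t (P (𝓕 u₁) + A (𝓕 u₀)), Lp.coeFn_add (P (𝓕 u₁)) (A (𝓕 u₀))]
      with η e0 e1 e2 e3 e4 e5 e6 e7 e8 e9 e10 e11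
    rw [e7, Pi.sub_apply, e8, Pi.sub_apply, e9, Pi.add_apply, e10, Pi.smul_apply, e11,
      Pi.add_apply, e1, e2, e3, e4, e5, e6]
    by_cases hη : freq η ≤ R
    · simp only [cutWeight, if_pos hη, Real.rpow_zero, Complex.ofReal_one, Complex.real_smul]
        at e0 ⊢
      linear_combination e0
    · simp [cutWeight, if_neg hη]
  -- Regularity in time is gained here: `hcutint` expresses `P (U t)` through the differentiable
  -- primitives `I₁` and `I₂`.
  have hV : ∀ t ∈ Set.Icc 0 T, HasDerivWithinAt (fun τ => P (U τ))
      (P (𝓕 u₁) + A (𝓕 u₀) - A (U t) - B (I₁ t)) (Set.Icc 0 T) t := by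
    intro t ht
    have h1 : HasDerivAt (fun τ : ℝ => P (𝓕 u₀) + τ • (P (𝓕 u₁) + A (𝓕 u₀)) - A (I₁ τ) - B (I₂ τ))
        (P (𝓕 u₁) + A (𝓕 u₀) - A (U t) - B (I₁ t)) t := by
      have h2 := (hasDerivAt_id t).smul_const (P (𝓕 u₁) + A (𝓕 u₀))
      rw [one_smul] at h2
      exact ((h2.const_add _).sub (A.hasFDerivAt.comp_hasDerivAt t (hI₁ t))).sub
        (B.hasFDerivAt.comp_hasDerivAt t (hI₂ t))
    exact h1.hasDerivWithinAt.congr (fun τ hτ => hcutint τ hτ.1) (hcutint t ht.1)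
  have hV' : ∀ t ∈ Set.Icc 0 T, HasDerivWithinAt
      (fun τ => P (𝓕 u₁) + A (𝓕 u₀) - A (U τ) - B (I₁ τ))
      (-A (P (𝓕 u₁) + A (𝓕 u₀) - A (U t) - B (I₁ t)) - B (P (U t))) (Set.Icc 0 T) t := by
    intro t ht
    have h1 := (A.hasFDerivAt.comp_hasDerivWithinAt t (hV t ht))
    have h2 := (B.hasFDerivAt.comp_hasDerivAt t (hI₁ t)).hasDerivWithinAt (s := Set.Icc 0 T)
    have h3 := (h1.const_sub (P (𝓕 u₁) + A (𝓕 u₀))).sub h2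
    rw [← hidem B _ hB (U t)] at h3
    refine h3.congr (fun τ _ => ?_) ?_ <;> simp only [Function.comp_apply, Pi.sub_apply, hidem A _ hA]
  have h0mem : (0 : ℝ) ∈ Set.Icc 0 T := ⟨le_rfl, hT⟩
  have hTmem : T ∈ Set.Icc 0 T := ⟨hT, le_rfl⟩
  have hU0 : U 0 = 𝓕 u₀ := by rw [hUeq 0 le_rfl, h.initial]
  have heq := secondOrder_unique A B hV hV' hSd hSd' (by
    refine Lp.ext ?_
    filter_upwards [hP (U 0), hS 0 h0mem] with η e1 e2
    rw [e1, e2, freqSol_zero, hU0]) (by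
    rw [hU0, hI₁0, map_zero, sub_zero, add_sub_cancel_right]
    refine Lp.ext ?_
    filter_upwards [hP (𝓕 u₁), hS' 0 h0mem] with η e1 e2
    rw [e1, e2, freqSolDeriv_zero]) hTmem
  simp only [hUeq T hT] at heq
  filter_upwards [hP (𝓕 (u T)), hS T hTmem] with η e1 e2 hη
  rw [heq, e2] at e1
  simpa [cutWeight, if_pos hη] using e1.symm

end representation

/-! ### Low frequencies, with `v = |ξ|^σ`, `b = v²` and `a ≤ v/2`. -/

section lowFrequency

variable {a v t : ℝ}

lemma kerOne_eq_sin (ha : a ^ 2 < v ^ 2) (t : ℝ) :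
    kerOne a (v ^ 2) t =
      (Real.exp (-a * t) * (Real.sin (√(v ^ 2 - a ^ 2) * t) / √(v ^ 2 - a ^ 2)) : ℝ) := by
  rw [kerOne, sinhQuot_rootGap_of_lt ha]; push_cast; rfl

lemma kerZero_eq_cos (ha : a ^ 2 < v ^ 2) (t : ℝ) :
    kerZero a (v ^ 2) t = (Real.exp (-a * t) * (Real.cos (√(v ^ 2 - a ^ 2) * t) +
      a * (Real.sin (√(v ^ 2 - a ^ 2) * t) / √(v ^ 2 - a ^ 2))) : ℝ) := by
  rw [kerZero, sinhQuot_rootGap_of_lt ha, cosh_rootGap_of_lt ha]; push_cast; rfl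

lemma kerOneDeriv_eq_cos (ha : a ^ 2 < v ^ 2) (t : ℝ) :
    kerOneDeriv a (v ^ 2) t = (Real.exp (-a * t) * (Real.cos (√(v ^ 2 - a ^ 2) * t) -
      a * (Real.sin (√(v ^ 2 - a ^ 2) * t) / √(v ^ 2 - a ^ 2))) : ℝ) := by
  rw [kerOneDeriv, sinhQuot_rootGap_of_lt ha, cosh_rootGap_of_lt ha]; push_cast; rfl

lemma sq_lt_of_le_half (hv : 0 < v) (ha : 0 ≤ a) (hav : a ≤ v / 2) : a ^ 2 < v ^ 2 := by
  nlinarith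

lemma half_le_sqrt (hv : 0 < v) (ha : 0 ≤ a) (hav : a ≤ v / 2) : v / 2 ≤ √(v ^ 2 - a ^ 2) :=
  Real.le_sqrt_of_sq_le (by nlinarith)

lemma sqrt_le_self_of_sq (hv : 0 < v) : √(v ^ 2 - a ^ 2) ≤ v :=
  Real.sqrt_le_iff.2 ⟨hv.le, by nlinarith [sq_nonneg a]⟩

/-- With `w` the square root, `(v - w)(v + w) = a²` and `v + w ≥ v`. -/
lemma sub_sqrt_le (hv : 0 < v) (ha : 0 ≤ a) (hav : a ≤ v / 2) :
    v - √(v ^ 2 - a ^ 2) ≤ a ^ 2 / v := by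
  have h1 := Real.sq_sqrt (by nlinarith : 0 ≤ v ^ 2 - a ^ 2)
  have h2 := sqrt_le_self_of_sq (a := a) hv
  have h3 := half_le_sqrt hv ha hav
  rw [le_div_iff₀ hv]
  nlinarith

lemma abs_sin_div_sqrt_le (hv : 0 < v) (ha : 0 ≤ a) (hav : a ≤ v / 2) (x : ℝ) :
    |Real.sin x / √(v ^ 2 - a ^ 2)| ≤ 2 / v := by
  have h := half_le_sqrt hv ha hav
  rw [abs_div, abs_of_nonneg (Real.sqrt_nonneg _), div_le_div_iff₀ (by linarith) hv]
  nlinarith [Real.abs_sin_le_one x, abs_nonneg (Real.sin x)]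

lemma norm_kerOne_le_low (hv : 0 < v) (ha : 0 ≤ a) (hav : a ≤ v / 2) :
    ‖kerOne a (v ^ 2) t‖ ≤ Real.exp (-a * t) * (2 / v) := by
  rw [kerOne_eq_sin (sq_lt_of_le_half hv ha hav), Complex.norm_real, Real.norm_eq_abs, abs_mul,
    abs_of_pos (Real.exp_pos _)]
  gcongr
  exact abs_sin_div_sqrt_le hv ha hav _

lemma abs_mul_sin_div_sqrt_le (hv : 0 < v) (ha : 0 ≤ a) (hav : a ≤ v / 2) (x : ℝ) :
    |a * (Real.sin x / √(v ^ 2 - a ^ 2))| ≤ 2 * (a / v) := by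
  rw [abs_mul, abs_of_nonneg ha]
  calc _ ≤ a * (2 / v) := by gcongr; exact abs_sin_div_sqrt_le hv ha hav _
    _ = _ := by ring

lemma two_mul_div_le_one (hv : 0 < v) (hav : a ≤ v / 2) : 2 * (a / v) ≤ 1 := by
  rw [← mul_div_assoc, div_le_one hv]; linarith

lemma norm_kerZero_le_low (hv : 0 < v) (ha : 0 ≤ a) (hav : a ≤ v / 2) :
    ‖kerZero a (v ^ 2) t‖ ≤ Real.exp (-a * t) * 2 := by
  rw [kerZero_eq_cos (sq_lt_of_le_half hv ha hav), Complex.norm_real, Real.norm_eq_abs, abs_mul,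
    abs_of_pos (Real.exp_pos _)]
  gcongr
  refine (abs_add_le _ _).trans ?_
  have h1 := Real.abs_cos_le_one (√(v ^ 2 - a ^ 2) * t)
  have h2 := abs_mul_sin_div_sqrt_le hv ha hav (√(v ^ 2 - a ^ 2) * t)
  have h3 := two_mul_div_le_one hv hav
  linarith

lemma norm_kerOneDeriv_le_low (hv : 0 < v) (ha : 0 ≤ a) (hav : a ≤ v / 2) :
    ‖kerOneDeriv a (v ^ 2) t‖ ≤ Real.exp (-a * t) * 2 := by
  rw [kerOneDeriv_eq_cos (sq_lt_of_le_half hv ha hav), Complex.norm_real, Real.norm_eq_abs, abs_mul,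
    abs_of_pos (Real.exp_pos _)]
  gcongr
  refine (abs_sub _ _).trans ?_
  have h1 := Real.abs_cos_le_one (√(v ^ 2 - a ^ 2) * t)
  have h2 := abs_mul_sin_div_sqrt_le hv ha hav (√(v ^ 2 - a ^ 2) * t)
  have h3 := two_mul_div_le_one hv hav
  linarith

lemma abs_sub_mul_le (hv : 0 < v) (ha : 0 ≤ a) (hav : a ≤ v / 2) (ht : 0 ≤ t) :
    |√(v ^ 2 - a ^ 2) * t - t * v| ≤ t * (a ^ 2 / v) := by
  have h1 := sub_sqrt_le hv ha hav
  have h2 := sqrt_le_self_of_sq (a := a) hv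
  rw [abs_sub_comm, show t * v - √(v ^ 2 - a ^ 2) * t = t * (v - √(v ^ 2 - a ^ 2)) by ring, abs_mul,
    abs_of_nonneg ht, abs_of_nonneg (by linarith)]
  gcongr

lemma norm_mul_kerOne_sub_le (hv : 0 < v) (ha : 0 ≤ a) (hav : a ≤ v / 2) (ht : 0 ≤ t) :
    ‖(v : ℂ) * kerOne a (v ^ 2) t - (Real.exp (-a * t) * Real.sin (t * v) : ℝ)‖ ≤
      Real.exp (-a * t) * (t * (a ^ 2 / v) + a / v) := by
  rw [kerOne_eq_sin (sq_lt_of_le_half hv ha hav), ← Complex.ofReal_mul, ← Complex.ofReal_sub,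
    Complex.norm_real, Real.norm_eq_abs]
  set w := √(v ^ 2 - a ^ 2) with hw
  have h1 := sub_sqrt_le hv ha hav
  have h2 := sqrt_le_self_of_sq (a := a) hv
  have h3 := half_le_sqrt hv ha hav
  rw [← hw] at h1 h2 h3
  have hw0 : 0 < w := by linarith
  -- The first term is a phase error, controlled because sine is 1-Lipschitz; the second is the
  -- amplitude error `v/w - 1`.
  have e : v * (Real.exp (-a * t) * (Real.sin (w * t) / w)) - Real.exp (-a * t) * Real.sin (t * v) =
      Real.exp (-a * t) * ((Real.sin (w * t) - Real.sin (t * v)) +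
        Real.sin (w * t) * ((v - w) / w)) := by field_simp; ring
  rw [e, abs_mul, abs_of_pos (Real.exp_pos _)]
  gcongr
  refine (abs_add_le _ _).trans (add_le_add ?_ ?_)
  · have h4 : |Real.sin (w * t) - Real.sin (t * v)| ≤ |w * t - t * v| := by
      simpa [Real.dist_eq] using Real.lipschitzWith_sin.dist_le_mul (w * t) (t * v)
    exact h4.trans (abs_sub_mul_le hv ha hav ht)
  · rw [abs_mul, abs_of_nonneg (div_nonneg (sub_nonneg.2 h2) hw0.le)]
    -- Indeed `(v - w)v ≤ a² ≤ aw`, since `a ≤ v/2 ≤ w`.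
    have h4 : (v - w) / w ≤ a / v := by
      rw [div_le_div_iff₀ hw0 hv]
      rw [le_div_iff₀ hv] at h1
      nlinarith
    calc _ ≤ 1 * ((v - w) / w) := by
          gcongr
          exact Real.abs_sin_le_one _
      _ ≤ _ := by rwa [one_mul]

lemma norm_kerOneDeriv_sub_le (hv : 0 < v) (ha : 0 ≤ a) (hav : a ≤ v / 2) (ht : 0 ≤ t) :
    ‖kerOneDeriv a (v ^ 2) t - (Real.exp (-a * t) * Real.cos (t * v) : ℝ)‖ ≤
      Real.exp (-a * t) * (t * (a ^ 2 / v) + 2 * (a / v)) := by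
  rw [kerOneDeriv_eq_cos (sq_lt_of_le_half hv ha hav), ← Complex.ofReal_sub,
    Complex.norm_real, Real.norm_eq_abs, ← mul_sub, abs_mul, abs_of_pos (Real.exp_pos _)]
  gcongr
  rw [sub_right_comm]
  refine (abs_sub _ _).trans (add_le_add ?_ (abs_mul_sin_div_sqrt_le hv ha hav _))
  have h4 : |Real.cos (√(v ^ 2 - a ^ 2) * t) - Real.cos (t * v)| ≤ |√(v ^ 2 - a ^ 2) * t - t * v| := by
    simpa [Real.dist_eq] using Real.lipschitzWith_cos.dist_le_mul (√(v ^ 2 - a ^ 2) * t) (t * v)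
  exact h4.trans (abs_sub_mul_le hv ha hav ht)

lemma norm_low_sol_le (hv : 0 < v) (hv1 : v ≤ 1) (ha : 0 ≤ a) (hav : a ≤ v / 2) (x y : ℂ) :
    ‖(v : ℂ) * (kerZero a (v ^ 2) t * x + kerOne a (v ^ 2) t * y)‖ ≤
      2 * Real.exp (-a * t) * (‖x‖ + ‖y‖) := by
  have h0 := norm_kerZero_le_low (t := t) hv ha hav
  have h1 := norm_kerOne_le_low (t := t) hv ha hav
  have he := (Real.exp_pos (-a * t)).le
  rw [norm_mul, Complex.norm_real, Real.norm_of_nonneg hv.le]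
  calc _ ≤ v * (Real.exp (-a * t) * 2 * ‖x‖ + Real.exp (-a * t) * (2 / v) * ‖y‖) := by
        gcongr
        refine (norm_add_le _ _).trans ?_
        rw [norm_mul, norm_mul]
        gcongr
    _ = v * (Real.exp (-a * t) * 2 * ‖x‖) + Real.exp (-a * t) * 2 * ‖y‖ := by field_simp
    _ ≤ 1 * (Real.exp (-a * t) * 2 * ‖x‖) + Real.exp (-a * t) * 2 * ‖y‖ := by gcongr
    _ = _ := by ring

/-- The factor `v` compensates the singularity `1/v` of the sine kernel and makes the contribution
of `x` an error of size `v`. The bound has the same shape as in `norm_low_deriv_sub_le`, so one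
limit argument handles both. -/
lemma norm_low_sol_sub_le (hv : 0 < v) (ha : 0 ≤ a) (hav : a ≤ v / 2) (ht : 0 ≤ t) (x y : ℂ) :
    ‖(v : ℂ) * (kerZero a (v ^ 2) t * x + kerOne a (v ^ 2) t * y) -
        (Real.exp (-a * t) * Real.sin (t * v) : ℝ) * y‖ ≤
      2 * Real.exp (-a * t) * (t * (a ^ 2 / v) + a / v + v) * (‖x‖ + ‖y‖) := by
  have h0 := norm_kerZero_le_low (t := t) hv ha hav
  have h1 := norm_mul_kerOne_sub_le hv ha hav ht
  have he := (Real.exp_pos (-a * t)).le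
  set err := t * (a ^ 2 / v) + a / v with herr
  have herr0 : 0 ≤ err := by positivity
  have e : (v : ℂ) * (kerZero a (v ^ 2) t * x + kerOne a (v ^ 2) t * y) -
        (Real.exp (-a * t) * Real.sin (t * v) : ℝ) * y = v * kerZero a (v ^ 2) t * x +
        (v * kerOne a (v ^ 2) t - (Real.exp (-a * t) * Real.sin (t * v) : ℝ)) * y := by ring
  rw [e]
  refine (norm_add_le _ _).trans ?_
  rw [norm_mul, norm_mul, norm_mul, Complex.norm_real, Real.norm_of_nonneg hv.le]
  calc _ ≤ v * (Real.exp (-a * t) * 2) * ‖x‖ + Real.exp (-a * t) * err * ‖y‖ := by gcongr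
    _ = 2 * Real.exp (-a * t) * (v * ‖x‖ + err / 2 * ‖y‖) := by ring
    _ ≤ 2 * Real.exp (-a * t) * ((err + v) * ‖x‖ + (err + v) * ‖y‖) := by gcongr <;> linarith
    _ = _ := by ring

lemma norm_low_deriv_le (hv : 0 < v) (hv1 : v ≤ 1) (ha : 0 ≤ a) (hav : a ≤ v / 2) (x y : ℂ) :
    ‖-((v ^ 2 : ℝ) : ℂ) * kerOne a (v ^ 2) t * x + kerOneDeriv a (v ^ 2) t * y‖ ≤
      2 * Real.exp (-a * t) * (‖x‖ + ‖y‖) := by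
  have h0 := norm_kerOneDeriv_le_low (t := t) hv ha hav
  have h1 := norm_kerOne_le_low (t := t) hv ha hav
  have he := (Real.exp_pos (-a * t)).le
  refine (norm_add_le _ _).trans ?_
  rw [norm_mul, norm_mul, norm_mul, norm_neg, Complex.norm_real, Real.norm_of_nonneg (by positivity)]
  calc _ ≤ v ^ 2 * (Real.exp (-a * t) * (2 / v)) * ‖x‖ + Real.exp (-a * t) * 2 * ‖y‖ := by gcongr
    _ = v * (2 * Real.exp (-a * t) * ‖x‖) + Real.exp (-a * t) * 2 * ‖y‖ := by field_simp
    _ ≤ 1 * (2 * Real.exp (-a * t) * ‖x‖) + Real.exp (-a * t) * 2 * ‖y‖ := by gcongr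
    _ = _ := by ring

lemma norm_low_deriv_sub_le (hv : 0 < v) (ha : 0 ≤ a) (hav : a ≤ v / 2) (ht : 0 ≤ t) (x y : ℂ) :
    ‖-((v ^ 2 : ℝ) : ℂ) * kerOne a (v ^ 2) t * x + kerOneDeriv a (v ^ 2) t * y -
        (Real.exp (-a * t) * Real.cos (t * v) : ℝ) * y‖ ≤
      2 * Real.exp (-a * t) * (t * (a ^ 2 / v) + a / v + v) * (‖x‖ + ‖y‖) := by
  have h0 := norm_kerOneDeriv_sub_le hv ha hav ht
  have h1 := norm_kerOne_le_low (t := t) hv ha hav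
  have he := (Real.exp_pos (-a * t)).le
  set err := t * (a ^ 2 / v) + a / v with herr
  have herr0 : 0 ≤ err := by positivity
  have h2 : t * (a ^ 2 / v) + 2 * (a / v) ≤ 2 * err := by
    have : 0 ≤ t * (a ^ 2 / v) := by positivity
    rw [herr]; linarith
  have e : -((v ^ 2 : ℝ) : ℂ) * kerOne a (v ^ 2) t * x + kerOneDeriv a (v ^ 2) t * y -
        (Real.exp (-a * t) * Real.cos (t * v) : ℝ) * y = -((v ^ 2 : ℝ) : ℂ) * kerOne a (v ^ 2) t * x +
        (kerOneDeriv a (v ^ 2) t - (Real.exp (-a * t) * Real.cos (t * v) : ℝ)) * y := by ring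
  rw [e]
  refine (norm_add_le _ _).trans ?_
  rw [norm_mul, norm_mul, norm_mul, norm_neg, Complex.norm_real, Real.norm_of_nonneg (by positivity)]
  calc _ ≤ v ^ 2 * (Real.exp (-a * t) * (2 / v)) * ‖x‖ + Real.exp (-a * t) * (2 * err) * ‖y‖ := by
        gcongr
        exact h0.trans (by gcongr)
    _ = 2 * Real.exp (-a * t) * (v * ‖x‖ + err * ‖y‖) := by field_simp
    _ ≤ 2 * Real.exp (-a * t) * ((err + v) * ‖x‖ + (err + v) * ‖y‖) := by gcongr <;> linarith
    _ = _ := by ring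

end lowFrequency

/-! ### High frequencies: exponential decay in time and smoothing. -/

section highFrequency

lemma exists_rpow_mul_exp_le {γ c : ℝ} (hγ : 0 < γ) (hc : 0 < c) (k : ℝ) :
    ∃ C, 0 ≤ C ∧ ∀ r : ℝ, 1 ≤ r → r ^ k * Real.exp (-c * r ^ γ) ≤ C := by
  obtain ⟨m, hm⟩ := exists_nat_ge (k / γ)
  -- The constant comes from `z ^ m / m! ≤ exp z` at `z = c r ^ γ`, with `m ≥ k / γ`.
  refine ⟨(m.factorial : ℝ) / c ^ m, by positivity, fun r hr => ?_⟩
  have h1 : r ^ k ≤ (r ^ γ) ^ m := by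
    rw [← Real.rpow_natCast, ← Real.rpow_mul (by linarith)]
    refine Real.rpow_le_rpow_of_exponent_le hr ?_
    rw [div_le_iff₀ hγ] at hm
    linarith
  have h2 := Real.pow_div_factorial_le_exp (c * r ^ γ) (by positivity) m
  rw [div_le_iff₀ (by positivity), mul_pow] at h2
  rw [neg_mul, Real.exp_neg, ← div_eq_mul_inv, div_le_div_iff₀ (Real.exp_pos _) (by positivity)]
  calc _ ≤ (r ^ γ) ^ m * c ^ m := by gcongr
    _ ≤ _ := by linarith

/-- Put `p = r^{2δ}` and `q = r^{2(σ-δ)}`, so that `r^{2σ} = pq`. Then `p²/4 - pq ≤ (p/2 - q/2)²`,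
and `q ≤ p` because `r ≥ 1` and `σ ≤ 2δ`. -/
lemma rootGap_re_add_le_high {σ δ r : ℝ} (hδ : σ / 2 < δ) (hr : 1 ≤ r) :
    (rootGap (r ^ (2 * δ) / 2) (r ^ (2 * σ))).re + r ^ (2 * (σ - δ)) / 2 ≤ r ^ (2 * δ) / 2 := by
  have h1 : r ^ (2 * σ) = r ^ (2 * δ) * r ^ (2 * (σ - δ)) := by
    rw [← Real.rpow_add (by linarith)]; congr 1; ring
  have h2 : r ^ (2 * (σ - δ)) ≤ r ^ (2 * δ) :=
    Real.rpow_le_rpow_of_exponent_le hr (by linarith)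
  have h3 : 0 < r ^ (2 * (σ - δ)) := Real.rpow_pos_of_pos (by linarith) _
  have h4 : √((r ^ (2 * δ) / 2) ^ 2 - r ^ (2 * σ)) ≤ r ^ (2 * δ) / 2 - r ^ (2 * (σ - δ)) / 2 := by
    rw [h1]
    exact Real.sqrt_le_iff.2 ⟨by linarith, by nlinarith⟩
  rw [rootGap_re]; linarith

variable {n : ℕ}

local notation "E" => EuclideanSpace ℝ (Fin n)

variable {σ δ : ℝ}

lemma exists_high_bound (hδ : σ / 2 < δ) (hδσ : δ < σ) {s t₀ : ℝ}
    (ht₀ : 0 < t₀) : ∃ C, 0 ≤ C ∧ ∀ t, t₀ ≤ t → ∀ (x y : E → ℂ) (η : E), 1 ≤ freq η →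
      ‖((freq η ^ s : ℝ) : ℂ) * freqSol σ δ x y t η‖ ≤
        C * ((1 + t) * Real.exp (-t / 4)) * (‖x η‖ + ‖y η‖) ∧
      ‖((freq η ^ s : ℝ) : ℂ) * freqSolDeriv σ δ x y t η‖ ≤
        C * ((1 + t) * Real.exp (-t / 4)) * (‖x η‖ + ‖y η‖) := by
  have hγ : 0 < 2 * (σ - δ) := by linarith
  obtain ⟨C, hC0, hC⟩ := exists_rpow_mul_exp_le hγ (c := t₀ / 4) (by positivity)
    (s + 2 * δ + 2 * σ)
  refine ⟨4 * C, by positivity, fun t ht x y η hη => ?_⟩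
  have ht0 : 0 < t := ht₀.trans_le ht
  have hr0 : 0 < freq η := by linarith
  have hμ := rootGap_re_add_le_high (σ := σ) hδ hη
  have b0 := norm_freqSol_le x y ht0.le hμ
  have b1 := norm_freqSolDeriv_le x y ht0.le hμ
  set r := freq η
  set X := ‖x η‖ + ‖y η‖
  have hX : 0 ≤ X := by positivity
  -- Half of the exponent gives decay in time, as the power of `r` is at least `1`; the other half,
  -- with `t ≥ t₀`, absorbs all powers of `r`.
  have hexp : Real.exp (-(r ^ (2 * (σ - δ)) / 2) * t) ≤
      Real.exp (-t / 4) * Real.exp (-(t₀ / 4) * r ^ (2 * (σ - δ))) := by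
    rw [← Real.exp_add]
    apply Real.exp_le_exp.2
    have : 1 ≤ r ^ (2 * (σ - δ)) := Real.one_le_rpow hη hγ.le
    nlinarith
  have hδ1 : 1 ≤ r ^ (2 * δ) := Real.one_le_rpow hη (by linarith)
  have hσ1 : 1 ≤ r ^ (2 * σ) := Real.one_le_rpow hη (by linarith)
  have hs0 : 0 < r ^ s := Real.rpow_pos_of_pos hr0 s
  have hpoly : 1 + (r ^ (2 * δ) / 2 + 1) * t ≤ 2 * r ^ (2 * δ) * (1 + t) := by nlinarith
  have main : r ^ s * ((1 + r ^ (2 * σ)) * ((1 + (r ^ (2 * δ) / 2 + 1) * t) *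
      Real.exp (-(r ^ (2 * (σ - δ)) / 2) * t) * X)) ≤ 4 * C * ((1 + t) * Real.exp (-t / 4)) * X := by
    calc _ ≤ r ^ s * ((2 * r ^ (2 * σ)) * ((2 * r ^ (2 * δ) * (1 + t)) *
          (Real.exp (-t / 4) * Real.exp (-(t₀ / 4) * r ^ (2 * (σ - δ)))) * X)) := by
          gcongr; linarith
      _ = 4 * (r ^ (s + 2 * δ + 2 * σ) * Real.exp (-(t₀ / 4) * r ^ (2 * (σ - δ)))) *
          ((1 + t) * Real.exp (-t / 4)) * X := by
          rw [Real.rpow_add hr0, Real.rpow_add hr0]; ring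
      _ ≤ _ := by gcongr; exact hC r hη
  rw [norm_mul, norm_mul, Complex.norm_real, Real.norm_of_nonneg hs0.le]
  refine ⟨le_trans ?_ main, le_trans ?_ main⟩
  · gcongr
    refine b0.trans (le_mul_of_one_le_left (by positivity) (by linarith))
  · gcongr

lemma exists_weighted_bound (hδ : σ / 2 < δ) (hδσ : δ < σ) {s t₀ : ℝ} (hs : 0 ≤ s)
    (ht₀ : 0 < t₀) : ∃ C, 0 ≤ C ∧ ∀ t, t₀ ≤ t → ∀ (x y : E → ℂ) (η : E),
      ‖((freq η ^ s : ℝ) : ℂ) * freqSol σ δ x y t η‖ ≤ C * (1 + t) * (‖x η‖ + ‖y η‖) ∧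
      ‖((freq η ^ s : ℝ) : ℂ) * freqSolDeriv σ δ x y t η‖ ≤ C * (1 + t) * (‖x η‖ + ‖y η‖) := by
  obtain ⟨C, hC0, hC⟩ := exists_high_bound (n := n) hδ hδσ (s := s) ht₀
  refine ⟨C + 4, by positivity, fun t ht x y η => ?_⟩
  have ht0 : 0 < t := ht₀.trans_le ht
  rcases le_total 1 (freq η) with h | h
  · have hle : C * ((1 + t) * Real.exp (-t / 4)) * (‖x η‖ + ‖y η‖) ≤
        (C + 4) * (1 + t) * (‖x η‖ + ‖y η‖) := by
      have : Real.exp (-t / 4) ≤ 1 := Real.exp_le_one_iff.2 (by linarith)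
      calc _ ≤ C * ((1 + t) * 1) * (‖x η‖ + ‖y η‖) := by gcongr
        _ ≤ _ := by rw [mul_one]; gcongr; linarith
    exact ⟨((hC t ht x y η h).1).trans hle, ((hC t ht x y η h).2).trans hle⟩
  · have hμ : (rootGap (freq η ^ (2 * δ) / 2) (freq η ^ (2 * σ))).re + 0 ≤ freq η ^ (2 * δ) / 2 := by
      rw [add_zero]
      exact rootGap_re_le (div_nonneg (freq_rpow_nonneg _ η) two_pos.le) (freq_rpow_nonneg _ η)
    have b0 := norm_freqSol_le x y ht0.le hμ
    have b1 := norm_freqSolDeriv_le x y ht0.le hμ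
    have p1 : freq η ^ (2 * δ) ≤ 1 := Real.rpow_le_one (freq_nonneg η) h (by linarith)
    have p2 : freq η ^ (2 * σ) ≤ 1 := Real.rpow_le_one (freq_nonneg η) h (by linarith)
    have p3 : freq η ^ s ≤ 1 := Real.rpow_le_one (freq_nonneg η) h hs
    have q1 := freq_rpow_nonneg (2 * δ) η
    have q2 := freq_rpow_nonneg (2 * σ) η
    have q3 := freq_rpow_nonneg s η
    rw [neg_zero, zero_mul, Real.exp_zero, mul_one] at b0 b1
    set X := ‖x η‖ + ‖y η‖
    have hX : 0 ≤ X := by positivity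
    have hbase : (1 + (freq η ^ (2 * δ) / 2 + 1) * t) * X ≤ 2 * (1 + t) * X := by
      gcongr; nlinarith
    rw [norm_mul, norm_mul, Complex.norm_real, Real.norm_of_nonneg q3]
    have hfin : 1 * (2 * (2 * (1 + t) * X)) ≤ (C + 4) * (1 + t) * X := by
      have : 0 ≤ C * ((1 + t) * X) := by positivity
      linarith
    refine ⟨le_trans ?_ hfin, le_trans ?_ hfin⟩
    · have : 0 ≤ 2 * (1 + t) * X := by positivity
      gcongr
      linarith [b0.trans hbase]
    · gcongr
      refine b1.trans ?_
      gcongr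
      linarith

/-- Smoothing: `|ξ|ˢ û(t)` lies in `L²` for `t > 0` and is differentiable there. -/
lemma exists_weighted_sol (hδ : σ / 2 < δ) (hδσ : δ < σ) {s : ℝ} (hs : 0 ≤ s)
    (x y : L2 n) : ∃ G G' : ℝ → L2 n,
      (∀ t, 0 < t → G t =ᵐ[volume] fun η => ((freq η ^ s : ℝ) : ℂ) * freqSol σ δ x y t η) ∧
      (∀ t, 0 < t → G' t =ᵐ[volume] fun η => ((freq η ^ s : ℝ) : ℂ) * freqSolDeriv σ δ x y t η) ∧
      (∀ t, 0 < t → HasDerivAt G (G' t) t) := by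
  have hxy : MemLp (fun η => ‖x η‖ + ‖y η‖) 2 (volume : Measure E) :=
    (Lp.memLp x).norm.add (Lp.memLp y).norm
  have hw := (Complex.measurable_ofReal.comp (measurable_freq_rpow (n := n) s)).aestronglyMeasurable
    (μ := volume)
  have h0 : ∀ t, ∃ G : L2 n, 0 < t →
      G =ᵐ[volume] fun η => ((freq η ^ s : ℝ) : ℂ) * freqSol σ δ x y t η := fun t => by
    by_cases ht : 0 < t
    · obtain ⟨C, -, hC⟩ := exists_weighted_bound (n := n) hδ hδσ hs ht
      have : MemLp (fun η => ((freq η ^ s : ℝ) : ℂ) * freqSol σ δ x y t η) 2 volume :=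
        (hxy.const_mul (C * (1 + t))).mono' (hw.mul (aestronglyMeasurable_freqSol σ δ
          (Lp.aestronglyMeasurable x) (Lp.aestronglyMeasurable y) t))
          (ae_of_all _ fun η => (hC t le_rfl x y η).1)
      exact ⟨this.toLp, fun _ => this.coeFn_toLp⟩
    · exact ⟨0, fun h => absurd h ht⟩
  have h1 : ∀ t, ∃ G : L2 n, 0 < t →
      G =ᵐ[volume] fun η => ((freq η ^ s : ℝ) : ℂ) * freqSolDeriv σ δ x y t η := fun t => by
    by_cases ht : 0 < t
    · obtain ⟨C, -, hC⟩ := exists_weighted_bound (n := n) hδ hδσ hs ht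
      have : MemLp (fun η => ((freq η ^ s : ℝ) : ℂ) * freqSolDeriv σ δ x y t η) 2 volume :=
        (hxy.const_mul (C * (1 + t))).mono' (hw.mul (aestronglyMeasurable_freqSolDeriv σ δ
          (Lp.aestronglyMeasurable x) (Lp.aestronglyMeasurable y) t))
          (ae_of_all _ fun η => (hC t le_rfl x y η).2)
      exact ⟨this.toLp, fun _ => this.coeFn_toLp⟩
    · exact ⟨0, fun h => absurd h ht⟩
  choose G hG using h0
  choose G' hG' using h1
  refine ⟨G, G', hG, hG', fun t ht => ?_⟩
  -- Starting from `t/2` gives a bound uniform on the neighbourhood `(t/2, 2t)`, hence one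
  -- dominating function.
  obtain ⟨C, hC0, hC⟩ := exists_weighted_bound (n := n) hδ hδσ hs (half_pos ht)
  have hmem : t ∈ Set.Ioo (t / 2) (2 * t) := ⟨by linarith, by linarith⟩
  refine (hasDerivWithinAt_Lp_of_dominated (convex_Ioo (t / 2) (2 * t))
    (hxy.const_mul (C * (1 + 2 * t))) (fun τ hτ => hG τ ((half_pos ht).trans hτ.1))
    (fun τ _ η => ((hasDerivAt_freqSol σ δ x y τ η).const_mul _).hasDerivWithinAt)
    (fun τ hτ η => ((hC τ hτ.1.le x y η).2).trans ?_) hmem (hG' t ht)).hasDerivAt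
    (Ioo_mem_nhds hmem.1 hmem.2)
  gcongr
  exact hτ.2.le

end highFrequency

/-! ### The parabolic-type dilation and the size of the profiles. -/

section scaling

variable {n : ℕ}

local notation "E" => EuclideanSpace ℝ (Fin n)

/-- In polar coordinates the squared norm has radial integrand `r^{n-1+2k} e^{-2b r^p}`; the lower
bound on `2k` is integrability at the origin. -/
lemma memLp_norm_rpow_mul_exp (hn : n ≠ 0) {k b p : ℝ} (hk : -(n : ℝ) < 2 * k) (hb : 0 < b)
    (hp : 0 < p) : MemLp (fun ζ : E => ‖ζ‖ ^ k * Real.exp (-b * ‖ζ‖ ^ p)) 2 volume := by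
  have : Nonempty (Fin n) := ⟨⟨0, Nat.pos_of_ne_zero hn⟩⟩
  have hm : Measurable fun ζ : E => ‖ζ‖ ^ k * Real.exp (-b * ‖ζ‖ ^ p) := by fun_prop
  rw [memLp_two_iff_integrable_sq_norm hm.aestronglyMeasurable]
  refine (integrable_fun_norm_addHaar (volume : Measure E)
    (f := fun r => ‖r ^ k * Real.exp (-b * r ^ p)‖ ^ 2)).2 ?_
  have h := integrableOn_rpow_mul_exp_neg_mul_rpow (p := p) (s := (n : ℝ) - 1 + 2 * k) (b := 2 * b)
    (by linarith) hp (by positivity)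
  refine h.congr_fun (fun r hr => ?_) measurableSet_Ioi
  have hr' : 0 < r := hr
  have h1 : ((n - 1 : ℕ) : ℝ) = n - 1 := by
    rw [Nat.cast_sub (Nat.pos_of_ne_zero hn)]; simp
  simp only [finrank_euclideanSpace, Fintype.card_fin, smul_eq_mul, Real.norm_eq_abs, sq_abs]
  rw [mul_pow, ← Real.exp_nat_mul, ← Real.rpow_natCast, ← Real.rpow_natCast (r ^ k),
    ← Real.rpow_mul hr'.le, h1, ← mul_assoc, ← Real.rpow_add hr']
  congr 2
  · push_cast; ring
  · push_cast; ring

lemma norm_sq_eq_integral {G : L2 n} {F : E → ℂ} (hG : G =ᵐ[volume] F) :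
    ‖G‖ ^ 2 = ∫ η, ‖F η‖ ^ 2 := by
  have h1 : inner ℂ G G = ((‖G‖ ^ 2 : ℝ) : ℂ) := by
    rw [inner_self_eq_norm_sq_to_K]; push_cast; rfl
  have h2 : (∫ η, inner ℂ (G η) (G η)) = ((∫ η, ‖F η‖ ^ 2 : ℝ) : ℂ) := by
    rw [← integral_complex_ofReal]
    refine integral_congr_ae ?_
    filter_upwards [hG] with η hη
    rw [hη, inner_self_eq_norm_sq_to_K]
    push_cast; rfl
  rw [L2.inner_def, h2] at h1
  exact (Complex.ofReal_injective h1).symm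

/-- The dilation factor under which `t |ξ|^{2δ}` becomes `|ζ|^{2δ}`. -/
def dilation (δ t : ℝ) : ℝ := (2 * Real.pi)⁻¹ * t ^ (-(1 / (2 * δ)))

lemma dilation_pos {δ t : ℝ} (ht : 0 < t) : 0 < dilation δ t := by
  unfold dilation; positivity

lemma freq_dilation_smul {δ t : ℝ} (ht : 0 < t) (ζ : E) :
    freq (dilation δ t • ζ) = t ^ (-(1 / (2 * δ))) * ‖ζ‖ := by
  have := dilation_pos (δ := δ) ht
  rw [freq_eq, norm_smul, Real.norm_of_nonneg this.le, dilation]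
  field_simp

lemma freq_dilation_smul_rpow {δ t : ℝ} (ht : 0 < t) (ζ : E) (k : ℝ) :
    freq (dilation δ t • ζ) ^ k = t ^ (-(k / (2 * δ))) * ‖ζ‖ ^ k := by
  rw [freq_dilation_smul ht, Real.mul_rpow (by positivity) (norm_nonneg _), ← Real.rpow_mul ht.le]
  congr 2; ring

lemma freq_dilation_smul_rpow_two {δ t : ℝ} (hδ : δ ≠ 0) (ht : 0 < t) (ζ : E) :
    freq (dilation δ t • ζ) ^ (2 * δ) * t = ‖ζ‖ ^ (2 * δ) := by
  rw [freq_dilation_smul_rpow ht, div_self (by simpa using hδ), Real.rpow_neg_one]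
  field_simp

/-- Change of variables. The factor `t^{k/(2δ)}` is kept inside the integral to turn `freq ^ k` into
`‖ζ‖ ^ k`, leaving the decay rate in front. -/
lemma norm_eq_dilated {δ t : ℝ} (ht : 0 < t) (k : ℝ) {G : L2 n} {F : E → ℂ}
    (hG : G =ᵐ[volume] F) :
    ‖G‖ = t ^ (-((n : ℝ) / (4 * δ)) - k / (2 * δ)) * √((2 * Real.pi)⁻¹ ^ n *
      ∫ ζ, (t ^ (k / (2 * δ)) * ‖F (dilation δ t • ζ)‖) ^ 2) := by
  have hd := dilation_pos (δ := δ) ht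
  have h1 := Measure.integral_comp_smul (volume : Measure E) (fun η => ‖F η‖ ^ 2) (dilation δ t)
  rw [finrank_euclideanSpace, Fintype.card_fin, abs_of_pos (by positivity), smul_eq_mul,
    ← norm_sq_eq_integral hG] at h1
  have h2 : ‖G‖ ^ 2 = dilation δ t ^ n * ∫ ζ, ‖F (dilation δ t • ζ)‖ ^ 2 := by
    rw [h1]; field_simp
  have h3 : ‖G‖ ^ 2 = (t ^ (-((n : ℝ) / (4 * δ)) - k / (2 * δ))) ^ 2 * ((2 * Real.pi)⁻¹ ^ n *
      ∫ ζ, (t ^ (k / (2 * δ)) * ‖F (dilation δ t • ζ)‖) ^ 2) := by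
    simp only [mul_pow]
    rw [integral_const_mul, h2, dilation, mul_pow]
    have h4 : (t ^ (-(1 / (2 * δ)))) ^ n = (t ^ (-((n : ℝ) / (4 * δ)) - k / (2 * δ))) ^ 2 *
        (t ^ (k / (2 * δ))) ^ 2 := by
      rw [← mul_pow, ← Real.rpow_add ht, ← Real.rpow_natCast, ← Real.rpow_natCast,
        ← Real.rpow_mul ht.le, ← Real.rpow_mul ht.le]
      congr 1; push_cast; ring
    rw [h4]; ring
  have h5 : 0 ≤ t ^ (-((n : ℝ) / (4 * δ)) - k / (2 * δ)) := by positivity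
  rw [← Real.sqrt_sq (norm_nonneg G), h3, Real.sqrt_mul (by positivity), Real.sqrt_sq h5]

/-- The diffusive-oscillating multiplier `|ξ|^k e^{-t|ξ|^{2δ}/2} θ(t|ξ|^σ)`. -/
def profile (σ δ k : ℝ) (θ : ℝ → ℝ) (t : ℝ) (η : E) : ℂ :=
  ((freq η ^ k * (Real.exp (-(freq η ^ (2 * δ) / 2) * t) * θ (t * freq η ^ σ)) : ℝ) : ℂ)

section

variable {σ δ k : ℝ} {θ : ℝ → ℝ}

lemma norm_profile_dilated (hδ : δ ≠ 0) {t : ℝ} (ht : 0 < t) (ζ : E) :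
    t ^ (k / (2 * δ)) * ‖profile σ δ k θ t (dilation δ t • ζ)‖ =
      ‖ζ‖ ^ k * Real.exp (-(1 / 2) * ‖ζ‖ ^ (2 * δ)) * |θ (t ^ (1 - σ / (2 * δ)) * ‖ζ‖ ^ σ)| := by
  rw [profile, Complex.norm_real, Real.norm_eq_abs, abs_mul, abs_mul, abs_of_pos (Real.exp_pos _),
    abs_of_nonneg (freq_rpow_nonneg _ _)]
  have h1 : -(freq (dilation δ t • ζ) ^ (2 * δ) / 2) * t = -(1 / 2) * ‖ζ‖ ^ (2 * δ) := by
    rw [← freq_dilation_smul_rpow_two hδ ht]; ring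
  have h2 : t * freq (dilation δ t • ζ) ^ σ = t ^ (1 - σ / (2 * δ)) * ‖ζ‖ ^ σ := by
    rw [freq_dilation_smul_rpow ht, ← mul_assoc, sub_eq_add_neg, Real.rpow_add ht, Real.rpow_one]
  have h3 : t ^ (k / (2 * δ)) * t ^ (-(k / (2 * δ))) = 1 := by
    rw [← Real.rpow_add ht]; simp
  rw [h1, h2, freq_dilation_smul_rpow ht]
  linear_combination (‖ζ‖ ^ k * Real.exp (-(1 / 2) * ‖ζ‖ ^ (2 * δ)) *
    |θ (t ^ (1 - σ / (2 * δ)) * ‖ζ‖ ^ σ)|) * h3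

/-- The substitution `x = τ y^σ` carries `[1, 2^{1/σ}]` onto `[τ, 2τ]`; its Jacobian `τ σ y^{σ-1}`
cancels the growth in `τ`. -/
lemma quarter_le_integral_sq_comp (hσ : 0 < σ) (hθ : Continuous θ)
    (hθ2 : ∀ τ, 4 ≤ τ → τ / 4 ≤ ∫ x in τ..2 * τ, θ x ^ 2) {τ : ℝ} (hτ : 4 ≤ τ) :
    1 / (4 * σ) ≤ ∫ y in (1 : ℝ)..2 ^ (1 / σ), y ^ (σ - 1) * θ (τ * y ^ σ) ^ 2 := by
  have h2 : (1 : ℝ) ≤ 2 ^ (1 / σ) := Real.one_le_rpow (by norm_num) (by positivity)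
  have hpos : ∀ x ∈ Set.uIcc (1 : ℝ) (2 ^ (1 / σ)), 0 < x := fun x hx => by
    rw [Set.uIcc_of_le h2] at hx; linarith [hx.1]
  have := intervalIntegral.integral_comp_mul_deriv (a := 1) (b := 2 ^ (1 / σ))
    (f := fun y => τ * y ^ σ) (f' := fun y => τ * (σ * y ^ (σ - 1))) (g := fun x => θ x ^ 2)
    (fun x hx => (Real.hasDerivAt_rpow_const (Or.inl (hpos x hx).ne')).const_mul τ)
    (fun x hx => by
      refine ContinuousAt.continuousWithinAt ?_
      have := Real.continuousAt_rpow_const x (σ - 1) (Or.inl (hpos x hx).ne')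
      fun_prop) (hθ.pow 2)
  have e1 : τ * ((2 : ℝ) ^ (1 / σ)) ^ σ = 2 * τ := by
    rw [← Real.rpow_mul (by norm_num), one_div_mul_cancel hσ.ne', Real.rpow_one]; ring
  simp only [Real.one_rpow, mul_one] at this
  rw [e1] at this
  have h3 := hθ2 τ hτ
  rw [← this] at h3
  have h4 : (∫ x in (1 : ℝ)..2 ^ (1 / σ), ((fun x => θ x ^ 2) ∘ fun y => τ * y ^ σ) x *
      (τ * (σ * x ^ (σ - 1)))) =
      τ * σ * ∫ y in (1 : ℝ)..2 ^ (1 / σ), y ^ (σ - 1) * θ (τ * y ^ σ) ^ 2 := by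
    rw [← intervalIntegral.integral_const_mul]
    congr 1; funext x; simp only [Function.comp]; ring
  rw [h4] at h3
  rw [div_le_iff₀ (by positivity)]
  nlinarith

/-- Two-sided bounds for the norm of the profile. -/
lemma profile_bounds (hn : n ≠ 0) (hσ : 0 < σ) (hδ : σ / 2 < δ) (hk : -(n : ℝ) < 2 * k)
    (hθ : Continuous θ) (hθ1 : ∀ x, |θ x| ≤ 1)
    (hθ2 : ∀ τ, 4 ≤ τ → τ / 4 ≤ ∫ x in τ..2 * τ, θ x ^ 2) {Q : ℝ → L2 n}
    (hQ : ∀ t, 0 < t → Q t =ᵐ[volume] profile σ δ k θ t) :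
    ∃ c₁ c₂ : ℝ, 0 < c₁ ∧ 0 < c₂ ∧ ∀ᶠ t : ℝ in atTop,
      c₁ * t ^ (-((n : ℝ) / (4 * δ)) - k / (2 * δ)) ≤ ‖Q t‖ ∧
      ‖Q t‖ ≤ c₂ * t ^ (-((n : ℝ) / (4 * δ)) - k / (2 * δ)) := by
  have : Nonempty (Fin n) := ⟨⟨0, Nat.pos_of_ne_zero hn⟩⟩
  have hδ0 : 0 < δ := by linarith
  set W : ℝ → ℝ := fun r => r ^ k * Real.exp (-(1 / 2) * r ^ (2 * δ)) with hW
  have hmem : MemLp (fun ζ : E => W ‖ζ‖) 2 volume :=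
    memLp_norm_rpow_mul_exp hn hk (by norm_num) (by linarith)
  have hint : Integrable (fun ζ : E => W ‖ζ‖ ^ 2) volume := hmem.integrable_sq
  set τ : ℝ → ℝ := fun t => t ^ (1 - σ / (2 * δ)) with hτ
  have hτlim : Tendsto τ atTop atTop := tendsto_rpow_atTop (by
    rw [sub_pos, div_lt_one (by linarith)]; linarith)
  set J : ℝ → ℝ := fun t => ∫ ζ : E, (W ‖ζ‖ * |θ (τ t * ‖ζ‖ ^ σ)|) ^ 2 with hJ
  have hnorm : ∀ t, 0 < t → ‖Q t‖ =
      t ^ (-((n : ℝ) / (4 * δ)) - k / (2 * δ)) * √((2 * Real.pi)⁻¹ ^ n * J t) := by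
    intro t ht
    rw [norm_eq_dilated (δ := δ) ht k (hQ t ht)]
    simp only [norm_profile_dilated hδ0.ne' ht, hJ, hW, hτ]
  have hJint : ∀ t, Integrable (fun ζ : E => (W ‖ζ‖ * |θ (τ t * ‖ζ‖ ^ σ)|) ^ 2) volume := by
    intro t
    refine hint.mono' ?_ (ae_of_all _ fun ζ => ?_)
    · have : Measurable fun ζ : E => (W ‖ζ‖ * |θ (τ t * ‖ζ‖ ^ σ)|) ^ 2 := by
        have hm := hθ.measurable
        simp only [hW]
        fun_prop
      exact this.aestronglyMeasurable
    · rw [mul_pow, Real.norm_of_nonneg (by positivity)]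
      refine mul_le_of_le_one_right (sq_nonneg _) ?_
      exact pow_le_one₀ (abs_nonneg _) (hθ1 _)
  have hJup : ∀ t, J t ≤ ∫ ζ : E, W ‖ζ‖ ^ 2 := fun t =>
    integral_mono (hJint t) hint fun ζ => by
      show (W ‖ζ‖ * |θ (τ t * ‖ζ‖ ^ σ)|) ^ 2 ≤ W ‖ζ‖ ^ 2
      rw [mul_pow]
      exact mul_le_of_le_one_right (sq_nonneg _) (pow_le_one₀ (abs_nonneg _) (hθ1 _))
  set ρ : ℝ := 2 ^ (1 / σ) with hρ
  have hρ1 : (1 : ℝ) ≤ ρ := Real.one_le_rpow (by norm_num) (by positivity)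
  -- On the compact annulus the radial density dominates a multiple of `y^{σ-1}`, the weight left by
  -- the substitution: `c` is the minimum of their positive continuous quotient.
  obtain ⟨c, hc0, hc⟩ : ∃ c, 0 < c ∧ ∀ y ∈ Set.Icc 1 ρ,
      c * y ^ (σ - 1) ≤ y ^ (n - 1) * W y ^ 2 := by
    have hcont : ContinuousOn (fun y : ℝ => y ^ (n - 1) * W y ^ 2 / y ^ (σ - 1)) (Set.Icc 1 ρ) := by
      intro y hy
      have hy0 : y ≠ 0 := by linarith [hy.1]
      have h1 := Real.continuousAt_rpow_const y k (Or.inl hy0)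
      have h2 := Real.continuousAt_rpow_const y (2 * δ) (Or.inl hy0)
      have h3 := Real.continuousAt_rpow_const y (σ - 1) (Or.inl hy0)
      have h4 : y ^ (σ - 1) ≠ 0 := (Real.rpow_pos_of_pos (by linarith [hy.1]) _).ne'
      simp only [hW]
      exact ContinuousAt.continuousWithinAt (by fun_prop (disch := assumption))
    obtain ⟨y₀, hy₀, hmin⟩ := isCompact_Icc.exists_isMinOn (Set.nonempty_Icc.2 hρ1) hcont
    have hy₀0 : 0 < y₀ := by linarith [hy₀.1]
    refine ⟨y₀ ^ (n - 1) * W y₀ ^ 2 / y₀ ^ (σ - 1), ?_, fun y hy => ?_⟩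
    · simp only [hW]; positivity
    · have hy0 : 0 < y := by linarith [hy.1]
      exact (le_div_iff₀ (Real.rpow_pos_of_pos hy0 _)).1 (hmin hy)
  set ω : ℝ := n * volume.real (Metric.ball (0 : E) 1) with hω
  have hω0 : 0 < ω := by
    have h1 : 0 < volume.real (Metric.ball (0 : E) 1) :=
      ENNReal.toReal_pos (Metric.measure_ball_pos volume _ one_pos).ne' measure_ball_lt_top.ne
    have h2 : (0 : ℝ) < n := by exact_mod_cast Nat.pos_of_ne_zero hn
    positivity
  have hJlow : ∀ t, 4 ≤ τ t → ω * (c / (4 * σ)) ≤ J t := by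
    intro t ht
    have hpolar := integral_fun_norm_addHaar (volume : Measure E)
      (fun y => (W y * |θ (τ t * y ^ σ)|) ^ 2)
    have hpint := (integrable_fun_norm_addHaar (volume : Measure E)
      (f := fun y => (W y * |θ (τ t * y ^ σ)|) ^ 2)).1 (hJint t)
    simp only [finrank_euclideanSpace, Fintype.card_fin, smul_eq_mul, nsmul_eq_mul] at hpolar hpint
    simp only [hJ]
    rw [hpolar, ← mul_assoc]
    gcongr
    have hsub : Set.Ioc 1 ρ ⊆ Set.Ioi (0 : ℝ) := fun y hy => lt_trans one_pos hy.1
    have hq := quarter_le_integral_sq_comp hσ hθ hθ2 ht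
    rw [intervalIntegral.integral_of_le hρ1] at hq
    calc c / (4 * σ) = c * (1 / (4 * σ)) := by ring
      _ ≤ c * ∫ y in Set.Ioc 1 ρ, y ^ (σ - 1) * θ (τ t * y ^ σ) ^ 2 := by gcongr
      _ = ∫ y in Set.Ioc 1 ρ, c * (y ^ (σ - 1) * θ (τ t * y ^ σ) ^ 2) := by
        rw [integral_const_mul]
      _ ≤ ∫ y in Set.Ioc 1 ρ, y ^ (n - 1) * (W y * |θ (τ t * y ^ σ)|) ^ 2 := by
        refine setIntegral_mono_on ?_ (hpint.mono_set hsub) measurableSet_Ioc fun y hy => ?_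
        · refine IntegrableOn.mono_set (t := Set.Icc 1 ρ) (ContinuousOn.integrableOn_Icc ?_)
            Set.Ioc_subset_Icc_self
          intro y hy
          have hy0 : y ≠ 0 := by linarith [hy.1]
          have h2 := Real.continuousAt_rpow_const y σ (Or.inl hy0)
          have h3 := Real.continuousAt_rpow_const y (σ - 1) (Or.inl hy0)
          have h4 : ContinuousAt (fun y => θ (τ t * y ^ σ)) y :=
            hθ.continuousAt.comp (by fun_prop : ContinuousAt (fun y => τ t * y ^ σ) y)
          exact ContinuousAt.continuousWithinAt (by fun_prop)
        · have h5 := hc y ⟨hy.1.le, hy.2⟩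
          rw [mul_pow, sq_abs, ← mul_assoc, ← mul_assoc]
          gcongr
      _ ≤ ∫ y in Set.Ioi (0 : ℝ), y ^ (n - 1) * (W y * |θ (τ t * y ^ σ)|) ^ 2 := by
        refine setIntegral_mono_set hpint ?_ hsub.eventuallyLE
        filter_upwards [self_mem_ae_restrict measurableSet_Ioi] with y hy
        have : (0 : ℝ) < y := hy
        simp only [Pi.zero_apply]
        positivity
  have hb0 : 0 ≤ ∫ ζ : E, W ‖ζ‖ ^ 2 := integral_nonneg fun _ => sq_nonneg _
  -- The `+ 1` makes the upper constant positive without a lower bound on the integral.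
  refine ⟨√((2 * Real.pi)⁻¹ ^ n * (ω * (c / (4 * σ)))),
    √((2 * Real.pi)⁻¹ ^ n * ∫ ζ : E, W ‖ζ‖ ^ 2) + 1, by positivity, by positivity, ?_⟩
  filter_upwards [hτlim.eventually_ge_atTop 4, eventually_gt_atTop 0] with t ht ht0
  have hp : 0 ≤ t ^ (-((n : ℝ) / (4 * δ)) - k / (2 * δ)) := by positivity
  rw [hnorm t ht0, mul_comm _ (√_)]
  refine ⟨?_, ?_⟩
  · gcongr
    exact hJlow t ht
  · gcongr
    refine (Real.sqrt_le_sqrt ?_).trans (le_add_of_nonneg_right one_pos.le)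
    gcongr
    exact hJup t

end

end scaling

/-! ### Asymptotics of the low-frequency part. -/

section asymptotics

variable {n : ℕ}

local notation "E" => EuclideanSpace ℝ (Fin n)

lemma isLittleO_of_dilated {δ k : ℝ} {L : ℝ → L2 n} {F : ℝ → E → ℂ} {g : E → ℝ}
    (hg : MemLp g 2 volume) (hL : ∀ t, 0 < t → L t =ᵐ[volume] F t)
    (hb : ∀ᶠ t : ℝ in atTop, ∀ᵐ ζ, t ^ (k / (2 * δ)) * ‖F t (dilation δ t • ζ)‖ ≤ g ζ)
    (hlim : ∀ᵐ ζ, Tendsto (fun t : ℝ => t ^ (k / (2 * δ)) * ‖F t (dilation δ t • ζ)‖) atTop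
      (nhds 0)) :
    (fun t => ‖L t‖) =o[atTop] fun t : ℝ => t ^ (-((n : ℝ) / (4 * δ)) - k / (2 * δ)) := by
  have hJ : Tendsto (fun t : ℝ => ∫ ζ, (t ^ (k / (2 * δ)) * ‖F t (dilation δ t • ζ)‖) ^ 2) atTop
      (nhds (∫ _ : E, (0 : ℝ))) := by
    refine tendsto_integral_filter_of_dominated_convergence (fun ζ => g ζ ^ 2) ?_ ?_
      hg.integrable_sq ?_
    · filter_upwards [eventually_gt_atTop 0] with t ht
      have h1 : AEStronglyMeasurable (F t) volume :=
        (Lp.aestronglyMeasurable (L t)).congr (hL t ht)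
      have h2 := h1.comp_quasiMeasurePreserving
        (Measure.quasiMeasurePreserving_smul (volume : Measure E) (dilation_pos (δ := δ) ht).ne')
      exact ((h2.norm.const_mul (t ^ (k / (2 * δ))))).pow 2
    · filter_upwards [hb, eventually_gt_atTop 0] with t h1 ht
      filter_upwards [h1] with ζ hζ
      rw [norm_pow, Real.norm_of_nonneg (by positivity)]
      gcongr
    · filter_upwards [hlim] with ζ hζ
      simpa using hζ.pow 2
  rw [integral_zero] at hJ
  have h0 : Tendsto (fun t : ℝ => √((2 * Real.pi)⁻¹ ^ n *
      ∫ ζ, (t ^ (k / (2 * δ)) * ‖F t (dilation δ t • ζ)‖) ^ 2)) atTop (nhds 0) := by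
    have := (Real.continuous_sqrt.tendsto _).comp (hJ.const_mul ((2 * Real.pi)⁻¹ ^ n))
    simpa [Function.comp_def] using this
  have h1 := (isLittleO_one_iff ℝ).2 h0
  have h2 := (isBigO_refl (fun t : ℝ => t ^ (-((n : ℝ) / (4 * δ)) - k / (2 * δ)))
    atTop).mul_isLittleO h1
  refine (h2.congr' ?_ ?_)
  · filter_upwards [eventually_gt_atTop 0] with t ht
    exact (norm_eq_dilated ht k (hL t ht)).symm
  · exact Eventually.of_forall fun t => mul_one _

lemma tendsto_freq_dilation_smul {δ : ℝ} (hδ : 0 < δ) (ζ : E) :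
    Tendsto (fun t => freq (dilation δ t • ζ)) atTop (nhds 0) := by
  have h := (tendsto_rpow_neg_atTop (y := 1 / (2 * δ)) (by positivity)).mul_const ‖ζ‖
  rw [zero_mul] at h
  refine h.congr' ?_
  filter_upwards [eventually_gt_atTop 0] with t ht
  rw [freq_dilation_smul ht]

lemma tendsto_dilation_smul {δ : ℝ} (hδ : 0 < δ) (ζ : E) :
    Tendsto (fun t => dilation δ t • ζ) atTop (nhds 0) := by
  rw [tendsto_zero_iff_norm_tendsto_zero]
  have h := (tendsto_freq_dilation_smul hδ ζ).const_mul (2 * Real.pi)⁻¹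
  rw [mul_zero] at h
  refine h.congr fun t => ?_
  rw [freq_eq]; field_simp

/-- Low frequencies: a multiplier with the profile as its leading part differs from it by `o`. -/
lemma low_frequency_isLittleO {σ δ k : ℝ} {θ : ℝ → ℝ} {Φ : ℝ → E → ℂ} {x y : E → ℂ} {N : ℝ}
    (hn : n ≠ 0) (hσ : 0 < σ) (hδ : σ / 2 < δ) (hk : -(n : ℝ) < 2 * k)
    (hx : ∀ η, ‖x η‖ ≤ N) (hy : ∀ η, ‖y η‖ ≤ N) (hyc : ContinuousAt y 0)
    (hθ1 : ∀ z, |θ z| ≤ 1)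
    (hΦ : ∀ t, 0 < t → ∀ η, 0 < freq η → freq η < 1 →
      ‖Φ t η‖ ≤ 2 * Real.exp (-(freq η ^ (2 * δ) / 2) * t) * (‖x η‖ + ‖y η‖))
    (hΦ' : ∀ t, 0 < t → ∀ η, 0 < freq η → freq η < 1 →
      ‖Φ t η - ((Real.exp (-(freq η ^ (2 * δ) / 2) * t) * θ (t * freq η ^ σ) : ℝ) : ℂ) * y η‖ ≤
        2 * Real.exp (-(freq η ^ (2 * δ) / 2) * t) *
          (t * ((freq η ^ (2 * δ) / 2) ^ 2 / freq η ^ σ) + freq η ^ (2 * δ) / 2 / freq η ^ σ +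
            freq η ^ σ) * (‖x η‖ + ‖y η‖))
    {L : ℝ → L2 n} (hL : ∀ t, 0 < t → L t =ᵐ[volume] fun η =>
      (if freq η < 1 then ((freq η ^ k : ℝ) : ℂ) * Φ t η else 0) - y 0 * profile σ δ k θ t η) :
    (fun t => ‖L t‖) =o[atTop] fun t : ℝ => t ^ (-((n : ℝ) / (4 * δ)) - k / (2 * δ)) := by
  have : Nonempty (Fin n) := ⟨⟨0, Nat.pos_of_ne_zero hn⟩⟩
  have hδ0 : 0 < δ := by linarith
  have hN : 0 ≤ N := (norm_nonneg _).trans (hx 0)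
  have hW : MemLp (fun ζ : E => ‖ζ‖ ^ k * Real.exp (-(1 / 2) * ‖ζ‖ ^ (2 * δ))) 2 volume :=
    memLp_norm_rpow_mul_exp hn hk (by norm_num) (by linarith)
  have hne : ∀ᵐ ζ : E, ζ ≠ 0 := by
    simp [ae_iff, measure_singleton]
  have hexp : ∀ {t : ℝ}, 0 < t → ∀ ζ : E, Real.exp (-(freq (dilation δ t • ζ) ^ (2 * δ) / 2) * t) =
      Real.exp (-(1 / 2) * ‖ζ‖ ^ (2 * δ)) := fun ht ζ => by
    rw [← freq_dilation_smul_rpow_two hδ0.ne' ht ζ]; congr 1; ring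
  have hfpos : ∀ {t : ℝ}, 0 < t → ∀ {ζ : E}, ζ ≠ 0 → 0 < freq (dilation δ t • ζ) := fun ht ζ hζ => by
    have := norm_pos_iff.2 hζ
    rw [freq_dilation_smul ht]; positivity
  have hcancel : ∀ {t : ℝ}, 0 < t → ∀ ζ : E,
      t ^ (k / (2 * δ)) * freq (dilation δ t • ζ) ^ k = ‖ζ‖ ^ k := fun ht ζ => by
    rw [freq_dilation_smul_rpow ht, ← mul_assoc, ← Real.rpow_add ht]; simp
  -- Of the constant `5N`, the multiplier contributes `2(N + N)` and the subtracted profile `‖y 0‖ ≤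
  -- N`.
  refine isLittleO_of_dilated (hW.const_mul (5 * N)) hL ?_ ?_
  · filter_upwards [eventually_gt_atTop 0] with t ht
    filter_upwards [hne] with ζ hζ
    have h1 : t ^ (k / (2 * δ)) * ‖profile σ δ k θ t (dilation δ t • ζ)‖ ≤
        ‖ζ‖ ^ k * Real.exp (-(1 / 2) * ‖ζ‖ ^ (2 * δ)) := by
      rw [norm_profile_dilated hδ0.ne' ht]
      exact mul_le_of_le_one_right (by positivity) (hθ1 _)
    have h2 : t ^ (k / (2 * δ)) * ‖if freq (dilation δ t • ζ) < 1 then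
        ((freq (dilation δ t • ζ) ^ k : ℝ) : ℂ) * Φ t (dilation δ t • ζ) else 0‖ ≤
        4 * N * (‖ζ‖ ^ k * Real.exp (-(1 / 2) * ‖ζ‖ ^ (2 * δ))) := by
      split_ifs with h
      · have h3 := hΦ t ht _ (hfpos ht hζ) h
        rw [hexp ht] at h3
        rw [norm_mul, Complex.norm_real, Real.norm_of_nonneg (freq_rpow_nonneg _ _), ← mul_assoc,
          hcancel ht]
        calc _ ≤ ‖ζ‖ ^ k * (2 * Real.exp (-(1 / 2) * ‖ζ‖ ^ (2 * δ)) * (N + N)) := by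
              gcongr
              refine h3.trans ?_
              gcongr
              exacts [hx _, hy _]
          _ = _ := by ring
      · rw [norm_zero, mul_zero]; positivity
    calc _ ≤ t ^ (k / (2 * δ)) * (‖if freq (dilation δ t • ζ) < 1 then
            ((freq (dilation δ t • ζ) ^ k : ℝ) : ℂ) * Φ t (dilation δ t • ζ) else 0‖ +
            ‖y 0‖ * ‖profile σ δ k θ t (dilation δ t • ζ)‖) := by
          gcongr
          refine (norm_sub_le _ _).trans ?_
          rw [norm_mul (y 0)]
      _ = t ^ (k / (2 * δ)) * ‖if freq (dilation δ t • ζ) < 1 then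
            ((freq (dilation δ t • ζ) ^ k : ℝ) : ℂ) * Φ t (dilation δ t • ζ) else 0‖ +
            ‖y 0‖ * (t ^ (k / (2 * δ)) * ‖profile σ δ k θ t (dilation δ t • ζ)‖) := by ring
      _ ≤ 4 * N * (‖ζ‖ ^ k * Real.exp (-(1 / 2) * ‖ζ‖ ^ (2 * δ))) +
            N * (‖ζ‖ ^ k * Real.exp (-(1 / 2) * ‖ζ‖ ^ (2 * δ))) := by
          gcongr
          exact hy 0
      _ = _ := by ring
  · filter_upwards [hne] with ζ hζ
    set r : ℝ → ℝ := fun t => freq (dilation δ t • ζ) with hr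
    have hr0 : Tendsto r atTop (nhds 0) := tendsto_freq_dilation_smul hδ0 ζ
    have hrk : ∀ {p : ℝ}, 0 < p → Tendsto (fun t => r t ^ p) atTop (nhds 0) := fun hp => by
      have := hr0.rpow_const (p := _) (Or.inr hp.le)
      rwa [Real.zero_rpow hp.ne'] at this
    have hylim : Tendsto (fun t => ‖y (dilation δ t • ζ) - y 0‖) atTop (nhds 0) := by
      have h1 := (hyc.tendsto.comp (tendsto_dilation_smul hδ0 ζ)).sub_const (y 0)
      simpa using h1.norm
    set Eζ := Real.exp (-(1 / 2) * ‖ζ‖ ^ (2 * δ)) with hEζ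
    -- For fixed `ζ` the product `t r^{2δ}` equals `‖ζ‖^{2δ}`, so every error term carries a
    -- positive power of `r → 0`; the last summand uses continuity of `y` at `0`.
    have hmaj : Tendsto (fun t => ‖ζ‖ ^ k * (2 * Eζ * (‖ζ‖ ^ (2 * δ) / 4 * r t ^ (2 * δ - σ) +
        r t ^ (2 * δ - σ) / 2 + r t ^ σ) * (N + N) + Eζ * ‖y (dilation δ t • ζ) - y 0‖))
        atTop (nhds 0) := by
      have h1 := hrk (p := 2 * δ - σ) (by linarith)
      have h2 := hrk hσ
      have h3 := ((((((h1.const_mul (‖ζ‖ ^ (2 * δ) / 4)).add (h1.div_const 2)).add h2).const_mul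
        (2 * Eζ)).mul_const (N + N)).add (hylim.const_mul Eζ)).const_mul (‖ζ‖ ^ k)
      simpa using h3
    refine squeeze_zero' ?_ ?_ hmaj
    · filter_upwards [eventually_gt_atTop 0] with t ht
      positivity
    · filter_upwards [eventually_gt_atTop 0, hr0.eventually_lt_const one_pos] with t ht hlt
      have hrp := hfpos ht hζ
      have h1 := hΦ' t ht _ hrp hlt
      rw [if_pos hlt]
      set η := dilation δ t • ζ with hη
      have hv : 0 < freq η ^ σ := Real.rpow_pos_of_pos hrp σ
      have e1 : freq η ^ (2 * δ) / 2 / freq η ^ σ = freq η ^ (2 * δ - σ) / 2 := by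
        rw [Real.rpow_sub hrp]; ring
      have e2 : t * ((freq η ^ (2 * δ) / 2) ^ 2 / freq η ^ σ) =
          ‖ζ‖ ^ (2 * δ) / 4 * freq η ^ (2 * δ - σ) := by
        rw [← freq_dilation_smul_rpow_two hδ0.ne' ht ζ, ← hη, Real.rpow_sub hrp]; ring
      rw [e1, e2, hexp ht, ← hEζ] at h1
      have e3 : ((freq η ^ k : ℝ) : ℂ) * Φ t η - y 0 * profile σ δ k θ t η = ((freq η ^ k : ℝ) : ℂ) *
          ((Φ t η - ((Eζ * θ (t * freq η ^ σ) : ℝ) : ℂ) * y η) +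
            ((Eζ * θ (t * freq η ^ σ) : ℝ) : ℂ) * (y η - y 0)) := by
        rw [profile, hexp ht, ← hEζ]; push_cast; ring
      have hE0 : 0 < Eζ := Real.exp_pos _
      rw [e3, norm_mul, Complex.norm_real, Real.norm_of_nonneg (freq_rpow_nonneg _ _), ← mul_assoc,
        hcancel ht]
      have hq := freq_rpow_nonneg (2 * δ - σ) η
      gcongr
      refine (norm_add_le _ _).trans (add_le_add ?_ ?_)
      · refine h1.trans ?_
        simp only [hr]
        gcongr
        exacts [hx _, hy _]
      · rw [norm_mul, Complex.norm_real, Real.norm_eq_abs, abs_mul, abs_of_pos hE0]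
        gcongr
        exact mul_le_of_le_one_right hE0.le (hθ1 _)

end asymptotics

/-! ### Combining the frequency zones; explicit symbols. -/

section multipliers

variable {n : ℕ}

local notation "E" => EuclideanSpace ℝ (Fin n)

lemma isLittleO_one_add_mul_exp (γ : ℝ) :
    (fun t : ℝ => (1 + t) * Real.exp (-t / 4)) =o[atTop] fun t : ℝ => t ^ γ := by
  have h := isLittleO_exp_neg_mul_rpow_atTop (a := 1 / 8) (by norm_num) γ
  refine IsBigO.trans_isLittleO (IsBigO.of_bound 8 ?_) h
  filter_upwards [eventually_ge_atTop 0] with t ht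
  rw [Real.norm_of_nonneg (by positivity), Real.norm_of_nonneg (Real.exp_pos _).le]
  have h1 : 1 + t ≤ 8 * Real.exp (t / 8) := by linarith [Real.add_one_le_exp (t / 8)]
  calc (1 + t) * Real.exp (-t / 4) ≤ 8 * Real.exp (t / 8) * Real.exp (-t / 4) := by gcongr
    _ = 8 * Real.exp (-(1 / 8) * t) := by rw [mul_assoc, ← Real.exp_add]; congr 2; ring

/-- Only the solution is split at frequency one: its high part `H` is exponentially small. The
profile stays whole, since after dilation its own high-frequency tail is covered by the same
dominated convergence. -/
lemma sub_profile_isLittleO {σ δ k : ℝ} {θ : ℝ → ℝ} {Φ Ψ : ℝ → E → ℂ} {x y : E → ℂ} {X : E → ℝ}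
    {N C : ℝ} (hn : n ≠ 0) (hσ : 0 < σ) (hδ : σ / 2 < δ) (hk : -(n : ℝ) < 2 * k)
    (hx : ∀ η, ‖x η‖ ≤ N) (hy : ∀ η, ‖y η‖ ≤ N) (hyc : ContinuousAt y 0)
    (hθ1 : ∀ z, |θ z| ≤ 1)
    (hΦ : ∀ t, 0 < t → ∀ η, 0 < freq η → freq η < 1 →
      ‖Φ t η‖ ≤ 2 * Real.exp (-(freq η ^ (2 * δ) / 2) * t) * (‖x η‖ + ‖y η‖))
    (hΦ' : ∀ t, 0 < t → ∀ η, 0 < freq η → freq η < 1 →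
      ‖Φ t η - ((Real.exp (-(freq η ^ (2 * δ) / 2) * t) * θ (t * freq η ^ σ) : ℝ) : ℂ) * y η‖ ≤
        2 * Real.exp (-(freq η ^ (2 * δ) / 2) * t) *
          (t * ((freq η ^ (2 * δ) / 2) ^ 2 / freq η ^ σ) + freq η ^ (2 * δ) / 2 / freq η ^ σ +
            freq η ^ σ) * (‖x η‖ + ‖y η‖))
    (hX : MemLp X 2 volume)
    (hhigh : ∀ t, 1 ≤ t → ∀ η, 1 ≤ freq η → ‖Ψ t η‖ ≤ C * ((1 + t) * Real.exp (-t / 4)) * X η)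
    (hlow : ∀ t, 0 < t → ∀ᵐ η, freq η < 1 → Ψ t η = ((freq η ^ k : ℝ) : ℂ) * Φ t η)
    {G Q : ℝ → L2 n} (hG : ∀ t, 0 < t → G t =ᵐ[volume] Ψ t)
    (hQ : ∀ t, 0 < t → Q t =ᵐ[volume] profile σ δ k θ t) :
    (fun t => ‖G t - y 0 • Q t‖) =o[atTop]
      fun t : ℝ => t ^ (-((n : ℝ) / (4 * δ)) - k / (2 * δ)) := by
  have hms : MeasurableSet {η : E | 1 ≤ freq η} := measurableSet_le measurable_const measurable_freq
  have hex : ∀ t, ∃ H : L2 n, H =ᵐ[volume] {η : E | 1 ≤ freq η}.indicator (G t) := fun t =>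
    ⟨((Lp.memLp (G t)).indicator hms).toLp, ((Lp.memLp (G t)).indicator hms).coeFn_toLp⟩
  choose H hH using hex
  have hHo : (fun t => ‖H t‖) =o[atTop] fun t : ℝ => t ^ (-((n : ℝ) / (4 * δ)) - k / (2 * δ)) := by
    refine IsBigO.trans_isLittleO (IsBigO.of_bound (|C| * ‖hX.toLp‖) ?_)
      (isLittleO_one_add_mul_exp _)
    filter_upwards [eventually_ge_atTop 1] with t ht
    have ht0 : 0 < t := by linarith
    have h0 : 0 ≤ (1 + t) * Real.exp (-t / 4) := by positivity
    rw [norm_norm, Real.norm_of_nonneg h0]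
    have h1 : ‖H t‖ ≤ (|C| * ((1 + t) * Real.exp (-t / 4))) * ‖hX.toLp‖ := by
      refine Lp.norm_le_mul_norm_of_ae_le_mul ?_
      filter_upwards [hH t, hG t ht0, hX.coeFn_toLp] with η e1 e2 e3
      rw [e1, e3]
      by_cases h : 1 ≤ freq η
      · rw [Set.indicator_of_mem (by exact h), e2]
        refine (hhigh t ht η h).trans ((le_abs_self _).trans_eq ?_)
        rw [abs_mul, abs_mul, abs_of_nonneg h0, Real.norm_eq_abs]
      · rw [Set.indicator_of_notMem (by exact h), norm_zero]
        positivity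
    exact h1.trans_eq (by ring)
  have hL := low_frequency_isLittleO (L := fun t => G t - y 0 • Q t - H t) hn hσ hδ hk hx hy hyc hθ1
    hΦ hΦ' (fun t ht => by
      filter_upwards [Lp.coeFn_sub (G t - y 0 • Q t) (H t), Lp.coeFn_sub (G t) (y 0 • Q t),
        Lp.coeFn_smul (y 0) (Q t), hH t, hG t ht, hQ t ht, hlow t ht] with η e1 e2 e3 e4 e5 e6 e7
      rw [e1, Pi.sub_apply, e2, Pi.sub_apply, e3, Pi.smul_apply, e4, e6, smul_eq_mul]
      by_cases h : freq η < 1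
      · rw [if_pos h, Set.indicator_of_notMem (by simpa using h), e5, e7 h, sub_zero]
      · rw [if_neg h, Set.indicator_of_mem (by simpa using h), e5]
        ring)
  refine IsBigO.trans_isLittleO (IsBigO.of_bound 1 (Eventually.of_forall fun t => ?_)) (hL.add hHo)
  rw [norm_norm, one_mul, Real.norm_of_nonneg (by positivity)]
  exact norm_le_norm_sub_add _ _

lemma bounds_of_isLittleO_sub {γ : ℝ} {P : ℂ} (hP : P ≠ 0) {G Q : ℝ → L2 n}
    (h : (fun t => ‖G t - P • Q t‖) =o[atTop] fun t : ℝ => t ^ γ)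
    (hQ : ∃ c₁ c₂ : ℝ, 0 < c₁ ∧ 0 < c₂ ∧ ∀ᶠ t : ℝ in atTop,
      c₁ * t ^ γ ≤ ‖Q t‖ ∧ ‖Q t‖ ≤ c₂ * t ^ γ) :
    ∃ c₁ c₂ : ℝ, 0 < c₁ ∧ 0 < c₂ ∧ ∀ᶠ t : ℝ in atTop,
      c₁ * t ^ γ ≤ ‖G t‖ ∧ ‖G t‖ ≤ c₂ * t ^ γ := by
  obtain ⟨c₁, c₂, hc₁, hc₂, hc⟩ := hQ
  have hP' : 0 < ‖P‖ := norm_pos_iff.2 hP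
  refine ⟨‖P‖ * c₁ / 2, ‖P‖ * c₂ + ‖P‖ * c₁ / 2, by positivity, by positivity, ?_⟩
  filter_upwards [hc, h.bound (c := ‖P‖ * c₁ / 2) (by positivity), eventually_gt_atTop 0]
    with t h1 h2 ht
  rw [norm_norm, Real.norm_of_nonneg (by positivity)] at h2
  have h3 : ‖P • Q t‖ = ‖P‖ * ‖Q t‖ := norm_smul _ _
  have h4 := norm_le_norm_add_norm_sub (G t) (P • Q t)
  have h5 := norm_le_norm_add_norm_sub' (G t) (P • Q t)
  have h6 := mul_le_mul_of_nonneg_left h1.1 hP'.le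
  have h7 := mul_le_mul_of_nonneg_left h1.2 hP'.le
  constructor <;> nlinarith

/-- The integral is `τ/2` plus boundary terms of size at most `1/2`. -/
lemma quarter_le_integral_sin_sq {τ : ℝ} (hτ : 4 ≤ τ) :
    τ / 4 ≤ ∫ x in τ..2 * τ, Real.sin x ^ 2 := by
  rw [integral_sin_sq]
  nlinarith [sq_nonneg (Real.sin τ + Real.cos τ), sq_nonneg (Real.sin (2 * τ) - Real.cos (2 * τ)),
    Real.sin_sq_add_cos_sq τ, Real.sin_sq_add_cos_sq (2 * τ)]

lemma quarter_le_integral_cos_sq {τ : ℝ} (hτ : 4 ≤ τ) :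
    τ / 4 ≤ ∫ x in τ..2 * τ, Real.cos x ^ 2 := by
  rw [integral_cos_sq]
  nlinarith [sq_nonneg (Real.sin τ - Real.cos τ), sq_nonneg (Real.sin (2 * τ) + Real.cos (2 * τ)),
    Real.sin_sq_add_cos_sq τ, Real.sin_sq_add_cos_sq (2 * τ)]

lemma memLp_profile {σ δ k : ℝ} {θ : ℝ → ℝ} (hn : n ≠ 0) (hδ : 0 < δ) (hk : -(n : ℝ) < 2 * k)
    (hθ : Continuous θ) (hθ1 : ∀ z, |θ z| ≤ 1) {t : ℝ} (ht : 0 < t) :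
    MemLp (profile (n := n) σ δ k θ t) 2 volume := by
  have h := (memLp_norm_rpow_mul_exp hn hk (b := t / 2 * (2 * Real.pi) ^ (2 * δ)) (p := 2 * δ)
    (by positivity) (by positivity)).const_mul ((2 * Real.pi) ^ k)
  refine h.mono' ?_ (ae_of_all _ fun η => ?_)
  · have hm := hθ.measurable
    have hf := measurable_freq (n := n)
    have : Measurable (profile (n := n) σ δ k θ t) := by unfold profile; fun_prop
    exact this.aestronglyMeasurable
  · rw [profile, Complex.norm_real, Real.norm_eq_abs, abs_mul, abs_mul, abs_of_pos (Real.exp_pos _),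
      abs_of_nonneg (freq_rpow_nonneg _ _), freq_eq, Real.mul_rpow (by positivity) (norm_nonneg _),
      Real.mul_rpow (by positivity) (norm_nonneg _), ← mul_assoc, ← mul_assoc]
    refine (mul_le_of_le_one_right (by positivity) (hθ1 _)).trans_eq ?_
    congr 2; ring

lemma ae_freq_pos (hn : n ≠ 0) : ∀ᵐ η : E, 0 < freq η := by
  have : Nonempty (Fin n) := ⟨⟨0, Nat.pos_of_ne_zero hn⟩⟩
  have hne : ∀ᵐ ζ : E, ζ ≠ 0 := by simp [ae_iff, measure_singleton]
  filter_upwards [hne] with η hη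
  rw [freq_eq]
  have := norm_pos_iff.2 hη
  positivity

lemma sinSymbol_smul (σ δ t : ℝ) (η : E) :
    sinSymbol σ δ t ((2 * Real.pi) • η) = profile σ δ (-σ) Real.sin t η := by
  rw [sinSymbol, profile, Real.rpow_neg (freq_nonneg η)]
  congr 1
  change Real.exp (-(1 / 2) * t * freq η ^ (2 * δ)) * (Real.sin (t * freq η ^ σ) / freq η ^ σ) = _
  rw [show -(1 / 2) * t * freq η ^ (2 * δ) = -(freq η ^ (2 * δ) / 2) * t by ring]
  ring

lemma cosSymbol_smul (σ δ t : ℝ) (η : E) :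
    cosSymbol σ δ t ((2 * Real.pi) • η) = profile σ δ 0 Real.cos t η := by
  rw [cosSymbol, profile, Real.rpow_zero, one_mul]
  congr 1
  change Real.exp (-(1 / 2) * t * freq η ^ (2 * δ)) * Real.cos (t * freq η ^ σ) = _
  rw [show -(1 / 2) * t * freq η ^ (2 * δ) = -(freq η ^ (2 * δ) / 2) * t by ring]

/-- Exponents of `rpow` need not add at base zero, so the origin, a null set, is left out. -/
lemma rpow_mul_profile {σ δ s k : ℝ} {θ : ℝ → ℝ} {t : ℝ} {η : E} (hη : 0 < freq η) :
    ((freq η ^ s : ℝ) : ℂ) * profile σ δ k θ t η = profile σ δ (s + k) θ t η := by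
  rw [profile, profile, ← Complex.ofReal_mul, ← mul_assoc, Real.rpow_add hη]

lemma memLp_sinSymbol {σ δ t : ℝ} (hn : n ≠ 0) (hσ : 2 * σ < (n : ℝ)) (hδ : 0 < δ) (ht : 0 < t) :
    MemLp (sinSymbol (n := n) σ δ t) 2 volume := by
  refine (memLp_norm_rpow_mul_exp hn (k := -σ) (b := t / 2) (p := 2 * δ) (by linarith)
    (by positivity) (by positivity)).mono' ?_ (ae_of_all _ fun ξ => ?_)
  · have : Measurable (sinSymbol (n := n) σ δ t) := by unfold sinSymbol; fun_prop
    exact this.aestronglyMeasurable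
  · rw [sinSymbol, Complex.norm_real, Real.norm_eq_abs, abs_mul, abs_div,
      abs_of_pos (Real.exp_pos _), abs_of_nonneg (Real.rpow_nonneg (norm_nonneg ξ) σ),
      Real.rpow_neg (norm_nonneg ξ), show -(1 / 2) * t * ‖ξ‖ ^ (2 * δ) = -(t / 2) * ‖ξ‖ ^ (2 * δ) by
        ring, mul_comm, div_eq_mul_inv]
    gcongr
    exact mul_le_of_le_one_left (by positivity) (Real.abs_sin_le_one _)

lemma memLp_cosSymbol {σ δ t : ℝ} (hn : n ≠ 0) (hδ : 0 < δ) (ht : 0 < t) :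
    MemLp (cosSymbol (n := n) σ δ t) 2 volume := by
  have hn' : (0 : ℝ) < n := by exact_mod_cast Nat.pos_of_ne_zero hn
  refine (memLp_norm_rpow_mul_exp hn (k := 0) (b := t / 2) (p := 2 * δ) (by linarith)
    (by positivity) (by positivity)).mono' ?_ (ae_of_all _ fun ξ => ?_)
  · have : Measurable (cosSymbol (n := n) σ δ t) := by unfold cosSymbol; fun_prop
    exact this.aestronglyMeasurable
  · rw [cosSymbol, Complex.norm_real, Real.norm_eq_abs, abs_mul, abs_of_pos (Real.exp_pos _),
      Real.rpow_zero, one_mul,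
      show -(1 / 2) * t * ‖ξ‖ ^ (2 * δ) = -(t / 2) * ‖ξ‖ ^ (2 * δ) by ring]
    exact mul_le_of_le_one_right (Real.exp_pos _).le (Real.abs_cos_le_one _)

section lowMultipliers

variable {σ δ : ℝ} {x y : EuclideanSpace ℝ (Fin n) → ℂ} {η : EuclideanSpace ℝ (Fin n)} {t : ℝ}

/-- This is the hypothesis `a ≤ v/2` of the low-frequency kernel estimates: since `σ ≤ 2δ`, damping
is weaker than oscillation below frequency one. -/
lemma half_rpow_le (hδ : σ / 2 < δ) (h0 : 0 < freq η) (h1 : freq η < 1) :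
    freq η ^ (2 * δ) / 2 ≤ freq η ^ σ / 2 := by
  have := Real.rpow_le_rpow_of_exponent_ge h0 h1.le (by linarith : σ ≤ 2 * δ)
  linarith

lemma rpow_two_mul_eq_sq (h0 : 0 < freq η) : freq η ^ (2 * σ) = (freq η ^ σ) ^ 2 := by
  rw [← Real.rpow_natCast, ← Real.rpow_mul h0.le]; congr 1; push_cast; ring

lemma norm_rpow_mul_freqSol_le (hσ : 0 < σ) (hδ : σ / 2 < δ) (h0 : 0 < freq η) (h1 : freq η < 1) :
    ‖((freq η ^ σ : ℝ) : ℂ) * freqSol σ δ x y t η‖ ≤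
      2 * Real.exp (-(freq η ^ (2 * δ) / 2) * t) * (‖x η‖ + ‖y η‖) := by
  rw [freqSol, rpow_two_mul_eq_sq (σ := σ) h0]
  exact norm_low_sol_le (by positivity) (Real.rpow_le_one h0.le h1.le hσ.le) (by positivity)
    (half_rpow_le hδ h0 h1) _ _

lemma norm_rpow_mul_freqSol_sub_le (hδ : σ / 2 < δ) (h0 : 0 < freq η) (h1 : freq η < 1)
    (ht : 0 < t) :
    ‖((freq η ^ σ : ℝ) : ℂ) * freqSol σ δ x y t η -
      ((Real.exp (-(freq η ^ (2 * δ) / 2) * t) * Real.sin (t * freq η ^ σ) : ℝ) : ℂ) * y η‖ ≤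
        2 * Real.exp (-(freq η ^ (2 * δ) / 2) * t) *
          (t * ((freq η ^ (2 * δ) / 2) ^ 2 / freq η ^ σ) + freq η ^ (2 * δ) / 2 / freq η ^ σ +
            freq η ^ σ) * (‖x η‖ + ‖y η‖) := by
  rw [freqSol, rpow_two_mul_eq_sq (σ := σ) h0]
  exact norm_low_sol_sub_le (by positivity) (by positivity) (half_rpow_le hδ h0 h1) ht.le _ _

lemma norm_freqSolDeriv_low_le (hσ : 0 < σ) (hδ : σ / 2 < δ) (h0 : 0 < freq η) (h1 : freq η < 1) :
    ‖freqSolDeriv σ δ x y t η‖ ≤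
      2 * Real.exp (-(freq η ^ (2 * δ) / 2) * t) * (‖x η‖ + ‖y η‖) := by
  rw [freqSolDeriv, rpow_two_mul_eq_sq (σ := σ) h0]
  exact norm_low_deriv_le (by positivity) (Real.rpow_le_one h0.le h1.le hσ.le) (by positivity)
    (half_rpow_le hδ h0 h1) _ _

lemma norm_freqSolDeriv_low_sub_le (hδ : σ / 2 < δ) (h0 : 0 < freq η) (h1 : freq η < 1)
    (ht : 0 < t) :
    ‖freqSolDeriv σ δ x y t η -
      ((Real.exp (-(freq η ^ (2 * δ) / 2) * t) * Real.cos (t * freq η ^ σ) : ℝ) : ℂ) * y η‖ ≤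
        2 * Real.exp (-(freq η ^ (2 * δ) / 2) * t) *
          (t * ((freq η ^ (2 * δ) / 2) ^ 2 / freq η ^ σ) + freq η ^ (2 * δ) / 2 / freq η ^ σ +
            freq η ^ σ) * (‖x η‖ + ‖y η‖) := by
  rw [freqSolDeriv, rpow_two_mul_eq_sq (σ := σ) h0]
  exact norm_low_deriv_sub_le (by positivity) (by positivity) (half_rpow_le hδ h0 h1) ht.le _ _

end lowMultipliers

lemma continuous_fourier_of_integrable {f : E → ℂ} (hf : Integrable f volume) :
    Continuous (𝓕 f) :=
  VectorFourier.fourierIntegral_continuous Real.continuous_fourierChar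
    (by exact continuous_inner) hf

lemma norm_fourier_le_integral (f : E → ℂ) (η : E) : ‖𝓕 f η‖ ≤ ∫ z, ‖f z‖ :=
  VectorFourier.norm_fourierIntegral_le_integral_norm _ _ _ _ _

lemma fourier_apply_zero (f : E → ℂ) : 𝓕 f 0 = ∫ z, f z := by
  rw [Real.fourier_eq]; simp

end multipliers

/-! ### Returning to physical space. -/

section conclusion

variable {n : ℕ}

local notation "E" => EuclideanSpace ℝ (Fin n)

lemma exists_profile_L2 {σ δ k : ℝ} {θ : ℝ → ℝ} (hn : n ≠ 0) (hδ : 0 < δ) (hk : -(n : ℝ) < 2 * k)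
    (hθ : Continuous θ) (hθ1 : ∀ z, |θ z| ≤ 1) :
    ∃ Q : ℝ → L2 n, ∀ t, 0 < t → Q t =ᵐ[volume] profile σ δ k θ t := by
  have : ∀ t, ∃ Q : L2 n, 0 < t → Q =ᵐ[volume] profile σ δ k θ t := fun t => by
    by_cases ht : 0 < t
    · exact ⟨(memLp_profile hn hδ hk hθ hθ1 ht).toLp, fun _ =>
        (memLp_profile hn hδ hk hθ hθ1 ht).coeFn_toLp⟩
    · exact ⟨0, fun h => absurd h ht⟩
  choose Q hQ using this
  exact ⟨Q, hQ⟩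

/-- The weighted Fourier-side representation of a multiplier whose symbol is a profile. -/
lemma fourier_invFourier_profile {σ δ s k t : ℝ} {θ : ℝ → ℝ} {m : E → ℂ} {Q₀ Q : L2 n} (hn : n ≠ 0)
    (hm : ∀ η, m ((2 * Real.pi) • η) = profile σ δ k θ t η)
    (hQ₀ : Q₀ =ᵐ[volume] profile σ δ k θ t) (hQ : Q =ᵐ[volume] profile σ δ (s + k) θ t) :
    Q =ᵐ[volume] fun η => ((freq η ^ s : ℝ) : ℂ) * (𝓕 (invFourier m : L2 n) : L2 n) η := by
  have h1 : invFourier m = 𝓕⁻ Q₀ := invFourier_eq (hQ₀.trans (ae_of_all _ fun η => (hm η).symm))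
  have h2 : (𝓕 (𝓕⁻ Q₀ : L2 n) : L2 n) = Q₀ := FourierTransform.fourier_fourierInv_eq Q₀
  rw [h1, h2]
  filter_upwards [hQ₀, hQ, ae_freq_pos hn] with η e1 e2 e3
  rw [e1, e2, rpow_mul_profile e3]

lemma fourierInv_sub_smul (c : ℂ) (f g : L2 n) :
    (𝓕⁻ (f - c • g) : L2 n) = 𝓕⁻ f - c • (𝓕⁻ g : L2 n) := by
  have h := (Lp.fourierTransformₗᵢ E ℂ).symm.map_sub f (c • g)
  rw [LinearIsometryEquiv.map_smul] at h
  exact h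

lemma absD_sub_smul {s : ℝ} (c : ℂ) {f g F G : L2 n}
    (hF : F =ᵐ[volume] fun η => ((freq η ^ s : ℝ) : ℂ) * (𝓕 f : L2 n) η)
    (hG : G =ᵐ[volume] fun η => ((freq η ^ s : ℝ) : ℂ) * (𝓕 g : L2 n) η) :
    absD s (f - c • g) = 𝓕⁻ (F - c • G) := by
  refine absD_eq ?_
  have h : (𝓕 (f - c • g) : L2 n) = 𝓕 f - c • (𝓕 g : L2 n) := by
    have h := (Lp.fourierTransformₗᵢ E ℂ).map_sub f (c • g)
    rw [LinearIsometryEquiv.map_smul] at h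
    exact h
  rw [h]
  filter_upwards [hF, hG, Lp.coeFn_sub F (c • G), Lp.coeFn_smul c G,
    Lp.coeFn_sub (𝓕 f : L2 n) (c • (𝓕 g : L2 n)), Lp.coeFn_smul c (𝓕 g : L2 n)]
    with η e1 e2 e3 e4 e5 e6
  rw [e3, e5, Pi.sub_apply, Pi.sub_apply, e4, e6, Pi.smul_apply, Pi.smul_apply, e1, e2]
  simp only [smul_eq_mul]; ring

end conclusion

end StructuralDamping

end

open StructuralDamping

theorem theorem1p2 (n : ℕ) (σ δ s : ℝ) (hσ : 1 ≤ σ) (hδ : σ / 2 < δ) (hδσ : δ < σ)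
    (hs : 0 ≤ s) (hn : 2 * σ < (n : ℝ)) (j : ℕ) (hj : j = 0 ∨ j = 1)
    (u₀ u₁ : StructuralDamping.L2 n)
    (hu₀ : Integrable u₀ volume) (hu₀' : StructuralDamping.MemH (s + 2 * (j : ℝ) * δ) u₀)
    (hu₁ : Integrable u₁ volume)
    (hu₁' : StructuralDamping.MemH (max (s + 2 * ((j : ℝ) - 1) * δ) 0) u₁)
    (u : ℝ → StructuralDamping.L2 n) (hu : StructuralDamping.IsSolution σ δ u₀ u₁ u) :
    -- all functions below are well defined and lie in the spaces where they are measured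
    (∀ t : ℝ, 0 < t →
      StructuralDamping.MemH s (u t) ∧
      DifferentiableAt ℝ (fun τ => StructuralDamping.absD s (u τ)) t ∧
      MemLp (StructuralDamping.sinSymbol (n := n) σ δ t) 2 volume ∧
      StructuralDamping.MemH s
        (StructuralDamping.invFourier (StructuralDamping.sinSymbol (n := n) σ δ t)) ∧
      MemLp (StructuralDamping.cosSymbol (n := n) σ δ t) 2 volume ∧
      StructuralDamping.MemH s
        (StructuralDamping.invFourier (StructuralDamping.cosSymbol (n := n) σ δ t))) ∧
    -- the profile of the solution
    ((fun t : ℝ => ‖StructuralDamping.absD s (u t - (∫ x, u₁ x) •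
        StructuralDamping.invFourier (StructuralDamping.sinSymbol (n := n) σ δ t))‖)
      =o[atTop] fun t : ℝ => t ^ (-((n : ℝ) / (4 * δ)) - s / (2 * δ) + σ / (2 * δ))) ∧
    -- the profile of its time derivative
    ((fun t : ℝ => ‖deriv (fun τ => StructuralDamping.absD s (u τ)) t - (∫ x, u₁ x) •
        StructuralDamping.absD s
          (StructuralDamping.invFourier (StructuralDamping.cosSymbol (n := n) σ δ t))‖)
      =o[atTop] fun t : ℝ => t ^ (-((n : ℝ) / (4 * δ)) - s / (2 * δ))) ∧
    -- two-sided bounds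
    ((∫ x, u₁ x) ≠ 0 →
      ∃ C₁ C₂ : ℝ, 0 < C₁ ∧ 0 < C₂ ∧ ∀ᶠ t : ℝ in atTop,
        C₁ * t ^ (-((n : ℝ) / (4 * δ)) - (s + ((j : ℝ) - 1) * σ) / (2 * δ))
            ≤ ‖iteratedDeriv j (fun τ => StructuralDamping.absD s (u τ)) t‖ ∧
        ‖iteratedDeriv j (fun τ => StructuralDamping.absD s (u τ)) t‖
            ≤ C₂ * t ^ (-((n : ℝ) / (4 * δ)) - (s + ((j : ℝ) - 1) * σ) / (2 * δ))) := by
  have hn0 : n ≠ 0 := by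
    rintro rfl
    simp only [Nat.cast_zero] at hn
    linarith
  have hσ0 : 0 < σ := by linarith
  have hδ0 : 0 < δ := by linarith
  have hn0' : (0 : ℝ) < n := by linarith
  set P : ℂ := ∫ x, u₁ x with hP
  set x : L2 n := 𝓕 u₀ with hx
  set y : L2 n := 𝓕 u₁ with hy
  obtain ⟨G, G', hG, hG', hGd⟩ := exists_weighted_sol hδ hδσ hs x y
  have hGu : ∀ t, 0 < t → G t =ᵐ[volume] fun η => ((freq η ^ s : ℝ) : ℂ) * (𝓕 (u t) : L2 n) η := by
    intro t ht
    filter_upwards [hG t ht, hu.fourier_eq hσ0.le hδ0.le ht.le] with η e1 e2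
    rw [e1, e2]
  have habs : ∀ t, 0 < t → absD s (u t) = 𝓕⁻ (G t) := fun t ht => absD_eq (hGu t ht)
  have hder : ∀ t, 0 < t → HasDerivAt (fun τ => absD s (u τ)) (𝓕⁻ (G' t)) t := by
    intro t ht
    refine (fourierInv_hasDerivAt (hGd t ht)).congr_of_eventuallyEq ?_
    filter_upwards [eventually_gt_nhds ht] with τ hτ
    exact habs τ hτ
  have hsinc : ∀ z, |Real.sin z| ≤ 1 := Real.abs_sin_le_one
  have hcosc : ∀ z, |Real.cos z| ≤ 1 := Real.abs_cos_le_one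
  -- `S₀` and `K₀` represent the bare symbols, `S` and `K` the same symbols weighted by `|ξ|^s`.
  -- Orders `-σ` and `s - σ` are admissible because `n > 2σ`.
  obtain ⟨S₀, hS₀⟩ := exists_profile_L2 (σ := σ) (k := -σ) hn0 hδ0 (by linarith)
    Real.continuous_sin hsinc
  obtain ⟨S, hS⟩ := exists_profile_L2 (σ := σ) (k := s + -σ) hn0 hδ0 (by linarith)
    Real.continuous_sin hsinc
  obtain ⟨K₀, hK₀⟩ := exists_profile_L2 (σ := σ) (k := 0) hn0 hδ0 (by linarith)
    Real.continuous_cos hcosc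
  obtain ⟨K, hK⟩ := exists_profile_L2 (σ := σ) (k := s + 0) hn0 hδ0 (by linarith)
    Real.continuous_cos hcosc
  have hSsym : ∀ t, 0 < t → S t =ᵐ[volume] fun η =>
      ((freq η ^ s : ℝ) : ℂ) * (𝓕 (invFourier (sinSymbol (n := n) σ δ t) : L2 n) : L2 n) η :=
    fun t ht => fourier_invFourier_profile hn0 (sinSymbol_smul σ δ t) (hS₀ t ht) (hS t ht)
  have hKsym : ∀ t, 0 < t → K t =ᵐ[volume] fun η =>
      ((freq η ^ s : ℝ) : ℂ) * (𝓕 (invFourier (cosSymbol (n := n) σ δ t) : L2 n) : L2 n) η :=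
    fun t ht => fourier_invFourier_profile hn0 (cosSymbol_smul σ δ t) (hK₀ t ht) (hK t ht)
  -- The Fourier integrals are bounded continuous representatives of `x` and `y`; pointwise bounds
  -- and the value at frequency zero make sense only for them.
  set h₀ : EuclideanSpace ℝ (Fin n) → ℂ := 𝓕 (u₀ : EuclideanSpace ℝ (Fin n) → ℂ) with hh₀
  set h₁ : EuclideanSpace ℝ (Fin n) → ℂ := 𝓕 (u₁ : EuclideanSpace ℝ (Fin n) → ℂ) with hh₁
  have hx0 : x =ᵐ[volume] h₀ := fourier_ae_eq_integral hu₀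
  have hy1 : y =ᵐ[volume] h₁ := fourier_ae_eq_integral hu₁
  have hPy : h₁ 0 = P := fourier_apply_zero _
  obtain ⟨N, hN₀, hN₁⟩ : ∃ N, (∀ η, ‖h₀ η‖ ≤ N) ∧ ∀ η, ‖h₁ η‖ ≤ N :=
    ⟨max (∫ z, ‖u₀ z‖) (∫ z, ‖u₁ z‖),
      fun η => (norm_fourier_le_integral _ η).trans (le_max_left _ _),
      fun η => (norm_fourier_le_integral _ η).trans (le_max_right _ _)⟩
  have hcont : ContinuousAt h₁ 0 := (continuous_fourier_of_integrable hu₁).continuousAt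
  have hX : MemLp (fun η => ‖x η‖ + ‖y η‖) 2 (volume : Measure (EuclideanSpace ℝ (Fin n))) :=
    (Lp.memLp x).norm.add (Lp.memLp y).norm
  obtain ⟨C, -, hC⟩ := exists_high_bound (n := n) hδ hδσ (s := s) one_pos
  -- The bounded multiplier is `|ξ|^σ û`; the compensating `|ξ|^{-σ}` goes into the order `s - σ` of
  -- the profile and accounts for the gain `t^{σ/(2δ)}`.
  have hsin : (fun t => ‖G t - P • S t‖) =o[atTop]
      fun t : ℝ => t ^ (-((n : ℝ) / (4 * δ)) - (s + -σ) / (2 * δ)) := by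
    rw [← hPy]
    refine sub_profile_isLittleO
      (Φ := fun t η => ((freq η ^ σ : ℝ) : ℂ) * freqSol σ δ h₀ h₁ t η) hn0 hσ0 hδ (by linarith)
      hN₀ hN₁ hcont hsinc (fun t _ η => norm_rpow_mul_freqSol_le hσ0 hδ)
      (fun t ht η h1 h2 => norm_rpow_mul_freqSol_sub_le hδ h1 h2 ht) hX
      (fun t ht η hη => (hC t ht x y η hη).1) (fun t ht => ?_) hG hS
    filter_upwards [hx0, hy1, ae_freq_pos hn0] with η e1 e2 e3 _
    rw [← mul_assoc, ← Complex.ofReal_mul, ← Real.rpow_add e3, neg_add_cancel_right, freqSol,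
      freqSol, e1, e2]
  have hcos : (fun t => ‖G' t - P • K t‖) =o[atTop]
      fun t : ℝ => t ^ (-((n : ℝ) / (4 * δ)) - (s + 0) / (2 * δ)) := by
    rw [← hPy]
    refine sub_profile_isLittleO (Φ := fun t η => freqSolDeriv σ δ h₀ h₁ t η) hn0 hσ0 hδ
      (by linarith) hN₀ hN₁ hcont hcosc (fun t _ η => norm_freqSolDeriv_low_le hσ0 hδ)
      (fun t ht η h1 h2 => norm_freqSolDeriv_low_sub_le hδ h1 h2 ht) hX
      (fun t ht η hη => (hC t ht x y η hη).2) (fun t ht => ?_) hG' hK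
    filter_upwards [hx0, hy1] with η e1 e2 _
    rw [add_zero, freqSolDeriv, freqSolDeriv, e1, e2]
  refine ⟨fun t ht => ⟨?_, (hder t ht).differentiableAt, memLp_sinSymbol hn0 hn hδ0 ht, ?_,
    memLp_cosSymbol hn0 hδ0 ht, ?_⟩, ?_, ?_, fun hP0 => ?_⟩
  · exact memH_of_memLp hs ((memLp_congr_ae (hGu t ht)).1 (Lp.memLp (G t)))
  · exact memH_of_memLp hs ((memLp_congr_ae (hSsym t ht)).1 (Lp.memLp (S t)))
  · exact memH_of_memLp hs ((memLp_congr_ae (hKsym t ht)).1 (Lp.memLp (K t)))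
  · refine hsin.congr' ?_ (Eventually.of_forall fun t => by ring_nf)
    filter_upwards [eventually_gt_atTop 0] with t ht
    rw [absD_sub_smul P (hGu t ht) (hSsym t ht), norm_fourierInv_eq]
  · refine hcos.congr' ?_ (Eventually.of_forall fun t => by ring_nf)
    filter_upwards [eventually_gt_atTop 0] with t ht
    rw [(hder t ht).deriv, absD_eq (hKsym t ht), ← fourierInv_sub_smul, norm_fourierInv_eq]
  · rcases hj with rfl | rfl
    · obtain ⟨c₁, c₂, hc₁, hc₂, hc⟩ := bounds_of_isLittleO_sub hP0 hsin
        (profile_bounds hn0 hσ0 hδ (by linarith) Real.continuous_sin hsinc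
          (fun τ => quarter_le_integral_sin_sq) hS)
      refine ⟨c₁, c₂, hc₁, hc₂, ?_⟩
      filter_upwards [hc, eventually_gt_atTop 0] with t h ht
      rw [iteratedDeriv_zero, habs t ht, norm_fourierInv_eq]
      convert h using 4 <;> · push_cast; ring
    · obtain ⟨c₁, c₂, hc₁, hc₂, hc⟩ := bounds_of_isLittleO_sub hP0 hcos
        (profile_bounds hn0 hσ0 hδ (by linarith) Real.continuous_cos hcosc
          (fun τ => quarter_le_integral_cos_sq) hK)
      refine ⟨c₁, c₂, hc₁, hc₂, ?_⟩
      filter_upwards [hc, eventually_gt_atTop 0] with t h ht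
      rw [iteratedDeriv_one, (hder t ht).deriv, norm_fourierInv_eq]
      convert h using 4 <;> · push_cast; ring
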